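/- Let $(M,g_M)$ and $(B,g_B)$ be smooth finite-dimensional semi-Riemannian manifolds (without boundary, of arbitrary signature), and let $\varepsilon\in\{1,-1\}$. Equip $M\times\mathbb R$ and $B\times\mathbb R$ with the product metrics $g_M+\varepsilon\,dt^2$ and $g_B+\varepsilon\,dt^2$. Let $\pi:(M,g_M)\to(B,g_B)$ be a harmonic semi-Riemannian submersion. That is, $\pi$ is smooth and surjective, every $d\pi_x$ is surjective, the fibers of $\pi$ are semi-Riemannian submanifolds of $M$ (i.e. $g_M$ is nondegenerate on $\ker d\pi_x$ for every $x$), $d\pi$ preserves the scalar products of vectors orthogonal to the fibers, and the mean curvature vector of each fiber vanishes identically. For a $C^2$ immersion $F:\Gamma\to N\times\mathbb R$ with nondegenerate induced metric $\gamma$ into a product $(N\times\mathbb R,\ g_N+\varepsilon\,dt^2)$, with second fundamental form $II$ and mean curvature vector $\vec H=\operatorname{tr}_\gamma II$ (the trace, not divided by the dimension), call $F$ a translating soliton if $\vec H=\partial_t^{\perp}$, where $\partial_t^\perp$ is the component of $\partial_t$ normal to $F$. For $w\in C^2(N)$, the graph map $x\mapsto(x,w(x))$ is a graphical translating soliton if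 it is a semi-Riemannian hypersurface (its nonzero normal vectors $\nu$ satisfy $\operatorname{sign}\langle\nu,\nu\rangle=\varepsilon'$ for a constant $\varepsilon'\in\{1,-1\}$) and a translating soliton. Let $u\in C^2(B)$, and let $F:B\to B\times\mathbb R$, $F(x)=(x,u(x))$, and $\widetilde F:M\to M\times\mathbb R$, $\widetilde F(x)=(x,u(\pi(x)))$. Then $\widetilde F$ is a graphical translating soliton if and only if $F$ is a graphical translating soliton. -/

import Mathlib

open Set Manifold ContDiff

noncomputable section

/-- A field of bilinear forms on the tangent spaces of `M`. -/
abbrev TangentBilinField {E H : Type*} [NormedAddCommGroup E] [NormedSpace ℝ E]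
    [TopologicalSpace H] (I : ModelWithCorners ℝ E H)
    (M : Type*) [TopologicalSpace M] [ChartedSpace H M] : Type _ :=
  ∀ x : M, TangentSpace I x →L[ℝ] TangentSpace I x →L[ℝ] ℝ

/-- `g` is a smooth semi-Riemannian metric: smooth, symmetric and nondegenerate, of any signature.
(The index is then locally constant.) -/
structure IsSemiRiemannianMetric {E H : Type*} [NormedAddCommGroup E] [NormedSpace ℝ E]
    [TopologicalSpace H] (I : ModelWithCorners ℝ E H)
    {M : Type*} [TopologicalSpace M] [ChartedSpace H M] [IsManifold I ∞ M]
    (g : TangentBilinField I M) : Prop where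
  symm : ∀ (x : M) (v w : TangentSpace I x), g x v w = g x w v
  nondegenerate : ∀ (x : M) (v : TangentSpace I x),
    (∀ w : TangentSpace I x, g x v w = 0) → v = 0
  smooth : ContMDiff I (I.prod 𝓘(ℝ, E →L[ℝ] E →L[ℝ] ℝ)) ∞
    (fun x : M => Bundle.TotalSpace.mk' (E →L[ℝ] E →L[ℝ] ℝ)
      (E := fun x : M => TangentSpace I x →L[ℝ] TangentSpace I x →L[ℝ] ℝ) x (g x))

/-- The metric `g` in the preferred chart `φ` at `x₀`: the pullback of `g` by `φ⁻¹`. -/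
def chartMetric {E H : Type*} [NormedAddCommGroup E] [NormedSpace ℝ E]
    [TopologicalSpace H] (I : ModelWithCorners ℝ E H)
    {M : Type*} [TopologicalSpace M] [ChartedSpace H M]
    (g : TangentBilinField I M) (x₀ : M) (y : E) : E →L[ℝ] E →L[ℝ] ℝ :=
  let gy : E →L[ℝ] E →L[ℝ] ℝ := g ((extChartAt I x₀).symm y)
  let A : E →L[ℝ] E := mfderivWithin 𝓘(ℝ, E) I (extChartAt I x₀).symm (range I) y
  gy.bilinearComp A A

/-- The Christoffel symbols of the first kind of `g` at `x₀` in the preferred chart at `x₀`: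
`g (∇_u v, w)` for the coordinate-constant vector fields `u, v, w`, where `∇` is the Levi-Civita
connection. -/
def christoffelFirst {E H : Type*} [NormedAddCommGroup E] [NormedSpace ℝ E]
    [TopologicalSpace H] (I : ModelWithCorners ℝ E H)
    {M : Type*} [TopologicalSpace M] [ChartedSpace H M]
    (g : TangentBilinField I M) (x₀ : M) (u v w : E) : ℝ :=
  let dg : E →L[ℝ] E →L[ℝ] E →L[ℝ] ℝ :=
    fderivWithin ℝ (chartMetric I g x₀) (range I) (extChartAt I x₀ x₀)
  (1 / 2) * (dg u v w + dg v u w - dg w u v)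

/-- The metric trace `∑ γ^{ij} b_{ij}` of a bilinear form `b` with respect to a nondegenerate
symmetric bilinear form `γ`; it does not depend on the basis. -/
def metricTrace {V : Type*} [AddCommGroup V] [Module ℝ V] [FiniteDimensional ℝ V]
    (γ b : V → V → ℝ) : ℝ :=
  let e := Module.finBasis ℝ V
  ((Matrix.of fun i j => γ (e i) (e j))⁻¹ * Matrix.of fun i j => b (e i) (e j)).trace

section Submanifolds

variable {E' H' : Type*} [NormedAddCommGroup E'] [NormedSpace ℝ E'] [TopologicalSpace H']
  (J : ModelWithCorners ℝ E' H') {N : Type*} [TopologicalSpace N] [ChartedSpace H' N]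
  {E H : Type*} [NormedAddCommGroup E] [NormedSpace ℝ E] [TopologicalSpace H]
  (I : ModelWithCorners ℝ E H) {M : Type*} [TopologicalSpace M] [ChartedSpace H M]

/-- The induced form `F^* g` at `x`. -/
def inducedMetric (g : TangentBilinField I M) (F : N → M) (x : N)
    (v w : TangentSpace J x) : ℝ :=
  g (F x) (mfderiv J I F x v) (mfderiv J I F x w)

/-- `ξ` is normal to `F` at `x`. -/
def IsNormalTo (g : TangentBilinField I M) (F : N → M) (x : N)
    (ξ : TangentSpace I (F x)) : Prop :=
  ∀ v : TangentSpace J x, g (F x) (mfderiv J I F x v) ξ = 0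

/-- `η` is the normal component of `X` along `F` at `x`. -/
def IsNormalComponent (g : TangentBilinField I M) (F : N → M) (x : N)
    (X η : TangentSpace I (F x)) : Prop :=
  IsNormalTo J I g F x η ∧ ∃ v : TangentSpace J x, X = mfderiv J I F x v + η

/-- The second fundamental form of `F` at `x` in the direction of the normal vector `ξ`:
`g (II (v, w), ξ) = g (∇_v (dF w), ξ)`, computed in the preferred charts at `x` and `F x` as
`g (D²F (v, w), ξ) + g (Γ (dF v, dF w), ξ)`. -/
def secondFundamentalForm (g : TangentBilinField I M) (F : N → M) (x : N)
    (ξ : TangentSpace I (F x)) (v w : TangentSpace J x) : ℝ :=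
  let D2F : E' →L[ℝ] E' →L[ℝ] E :=
    fderivWithin ℝ (fderivWithin ℝ (writtenInExtChartAt J I x F) (range J)) (range J)
      (extChartAt J x x)
  g (F x) (D2F v w : E) ξ +
    christoffelFirst I g (F x) (mfderiv J I F x v) (mfderiv J I F x w) ξ

/-- `η` is the mean curvature vector of `F` at `x`: the trace (not divided by the dimension) of
the second fundamental form with respect to the induced metric, a normal vector. -/
def IsMeanCurvatureVector [FiniteDimensional ℝ E'] (g : TangentBilinField I M)
    (F : N → M) (x : N) (η : TangentSpace I (F x)) : Prop :=
  IsNormalTo J I g F x η ∧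
    ∀ ξ : TangentSpace I (F x), IsNormalTo J I g F x ξ →
      g (F x) η ξ =
        metricTrace (V := E') (inducedMetric J I g F x) (secondFundamentalForm J I g F x ξ)

/-- `F` is a `C²` immersion with nondegenerate induced metric. -/
structure IsSemiRiemannianImmersion (g : TangentBilinField I M) (F : N → M) : Prop where
  contMDiff : ContMDiff J I 2 F
  injective_mfderiv : ∀ x : N, Function.Injective (mfderiv J I F x)
  nondegenerate : ∀ (x : N) (v : TangentSpace J x),
    (∀ w : TangentSpace J x, inducedMetric J I g F x v w = 0) → v = 0

/-- `F` is a semi-Riemannian hypersurface of sign `ε'`: nonzero normal vectors `ν` have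
`sign (g (ν, ν)) = ε'`. -/
structure IsSemiRiemannianHypersurface (g : TangentBilinField I M) (F : N → M) (ε' : ℝ) :
    Prop extends IsSemiRiemannianImmersion J I g F where
  codim_one : Module.finrank ℝ E = Module.finrank ℝ E' + 1
  sign_eq : ε' = 1 ∨ ε' = -1
  normal_sign : ∀ (x : N) (ν : TangentSpace I (F x)),
    IsNormalTo J I g F x ν → ν ≠ 0 → 0 < ε' * g (F x) ν ν

end Submanifolds

section Solitons

variable {E H : Type*} [NormedAddCommGroup E] [NormedSpace ℝ E] [TopologicalSpace H]
  (I : ModelWithCorners ℝ E H) {M : Type*} [TopologicalSpace M] [ChartedSpace H M]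

/-- The product metric `g + ε dt²` on `M × ℝ`. -/
def productMetric (g : TangentBilinField I M) (ε : ℝ) :
    TangentBilinField (I.prod 𝓘(ℝ, ℝ)) (M × ℝ) := fun p =>
  let gp : E →L[ℝ] E →L[ℝ] ℝ := g p.1
  (gp.bilinearComp (ContinuousLinearMap.fst ℝ E ℝ) (ContinuousLinearMap.fst ℝ E ℝ) +
    ε • (ContinuousLinearMap.mul ℝ ℝ).bilinearComp
      (ContinuousLinearMap.snd ℝ E ℝ) (ContinuousLinearMap.snd ℝ E ℝ) :
    (E × ℝ) →L[ℝ] (E × ℝ) →L[ℝ] ℝ)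

/-- The vector field `∂_t` on `M × ℝ`. -/
def partialT (p : M × ℝ) : TangentSpace (I.prod 𝓘(ℝ, ℝ)) p := ((0, 1) : E × ℝ)

/-- `F : Γ → M × ℝ` is a (vertical) translating soliton in `(M × ℝ, g + ε dt²)`: a semi-Riemannian
submanifold whose mean curvature vector is the normal component of `∂_t`. -/
def IsTranslatingSoliton {E' H' : Type*} [NormedAddCommGroup E'] [NormedSpace ℝ E']
    [FiniteDimensional ℝ E'] [TopologicalSpace H'] (J : ModelWithCorners ℝ E' H')
    {Γ : Type*} [TopologicalSpace Γ] [ChartedSpace H' Γ]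
    (g : TangentBilinField I M) (ε : ℝ) (F : Γ → M × ℝ) : Prop :=
  IsSemiRiemannianImmersion J (I.prod 𝓘(ℝ, ℝ)) (productMetric I g ε) F ∧
    ∀ x : Γ, ∃ η : TangentSpace (I.prod 𝓘(ℝ, ℝ)) (F x),
      IsMeanCurvatureVector J (I.prod 𝓘(ℝ, ℝ)) (productMetric I g ε) F x η ∧
      IsNormalComponent J (I.prod 𝓘(ℝ, ℝ)) (productMetric I g ε) F x (partialT I (F x)) η

/-- The graph map `x ↦ (x, u x)`. -/
def graphMap {M : Type*} (u : M → ℝ) (x : M) : M × ℝ := (x, u x)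

/-- The graph of `u` is a graphical translating soliton in `(M × ℝ, g + ε dt²)`: the graph map is
a semi-Riemannian hypersurface (of a sign `ε' = ±1`) and a translating soliton. -/
def IsGraphicalTranslatingSoliton [FiniteDimensional ℝ E]
    (g : TangentBilinField I M) (ε : ℝ) (u : M → ℝ) : Prop :=
  (∃ ε' : ℝ, IsSemiRiemannianHypersurface I (I.prod 𝓘(ℝ, ℝ)) (productMetric I g ε)
    (graphMap u) ε') ∧
  IsTranslatingSoliton I I g ε (graphMap u)

end Solitons

section Submersions

variable {EM HM : Type*} [NormedAddCommGroup EM] [NormedSpace ℝ EM] [TopologicalSpace HM]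
  (IM : ModelWithCorners ℝ EM HM) {M : Type*} [TopologicalSpace M] [ChartedSpace HM M]
  {EB HB : Type*} [NormedAddCommGroup EB] [NormedSpace ℝ EB] [TopologicalSpace HB]
  (IB : ModelWithCorners ℝ EB HB) {B : Type*} [TopologicalSpace B] [ChartedSpace HB B]

/-- `π : (M, gM) → (B, gB)` is a semi-Riemannian submersion: a smooth map onto `B` with surjective
differentials, whose fibers are nondegenerate and whose differential preserves scalar products of
horizontal vectors, i.e. vectors orthogonal to the fibers. -/
structure IsSemiRiemannianSubmersion (gM : TangentBilinField IM M) (gB : TangentBilinField IB B)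
    (π : M → B) : Prop where
  smooth : ContMDiff IM IB ∞ π
  surjective : Function.Surjective π
  surjective_mfderiv : ∀ x : M, Function.Surjective (mfderiv IM IB π x)
  fiber_nondegenerate : ∀ (x : M) (v : TangentSpace IM x), mfderiv IM IB π x v = 0 →
    (∀ w : TangentSpace IM x, mfderiv IM IB π x w = 0 → gM x v w = 0) → v = 0
  isometry_horizontal : ∀ (x : M) (v w : TangentSpace IM x),
    (∀ z : TangentSpace IM x, mfderiv IM IB π x z = 0 → gM x v z = 0) →
    (∀ z : TangentSpace IM x, mfderiv IM IB π x z = 0 → gM x w z = 0) →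
    gB (π x) (mfderiv IM IB π x v) (mfderiv IM IB π x w) = gM x v w

/-- `f`, on the open set `U ∋ 0` of `ℝ^k`, is a local parametrization of the fiber of `π` through
`x`, with `f 0 = x`: a smooth immersion into the fiber, `k` being the dimension of the fiber. -/
structure IsFiberParametrization (π : M → B) (x : M) {k : ℕ}
    (f : EuclideanSpace ℝ (Fin k) → M) (U : Set (EuclideanSpace ℝ (Fin k))) : Prop where
  isOpen : IsOpen U
  zero_mem : (0 : EuclideanSpace ℝ (Fin k)) ∈ U
  map_zero : f 0 = x
  smoothOn : ContMDiffOn (𝓡 k) IM ∞ f U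
  injective_mfderiv : ∀ y ∈ U, Function.Injective (mfderiv (𝓡 k) IM f y)
  mem_fiber : ∀ y ∈ U, π (f y) = π x
  dim_eq : k + Module.finrank ℝ EB = Module.finrank ℝ EM

/-- The fibers of `π` are minimal: at each point `x` the mean curvature vector of the fiber
through `x`, computed in a local parametrization of the fiber around `x`, vanishes. -/
def HasMinimalFibers (gM : TangentBilinField IM M) (π : M → B) : Prop :=
  ∀ x : M, ∃ (k : ℕ) (f : EuclideanSpace ℝ (Fin k) → M) (U : Set (EuclideanSpace ℝ (Fin k))),
    IsFiberParametrization IM (EB := EB) π x f U ∧ IsMeanCurvatureVector (𝓡 k) IM gM f 0 0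

/-- A harmonic semi-Riemannian submersion: a semi-Riemannian submersion with minimal fibers. -/
structure IsHarmonicSubmersion (gM : TangentBilinField IM M) (gB : TangentBilinField IB B)
    (π : M → B) : Prop extends IsSemiRiemannianSubmersion IM IB gM gB π where
  minimal_fibers : HasMinimalFibers IM (EB := EB) gM π

end Submersions

end

/-! Being a graphical soliton reduces to a scalar equation. The normals to the graph of `w` are `ν_s
= (-εs ∇w, s)`, with square `s² W` where `W = ε + |∇w|²`. In the direction `ν_s` the second
fundamental form is `εs Hess w`, and `⟨∂_t, ν_s⟩ = εs`. So the graph is a graphical translating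
soliton exactly when `W` has constant sign and `tr_γ Hess w = 1`, with `γ = g + ε dw ⊗ dw`
(`isGraphicalTranslatingSoliton_iff`).

It remains to compare these two conditions for `u ∘ π` and for `u`. The gradient of `u ∘ π` is the
horizontal lift of the gradient of `u`, so `W` is unchanged. Since `d(u ∘ π)` kills vertical
vectors, the vertical and horizontal spaces are `γ`-orthogonal and the trace splits
(`metricTrace_eq_add_of_orthogonal`). On horizontal vectors `dπ` carries both the induced metric and
the Hessian to those of `u` (`hessianForm_horizontal`, resting on `christoffel_horizontal`). On
vertical vectors the Hessian is minus the second fundamental form of the fiber in the direction of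
the gradient, because `u ∘ π` is constant on fibers (`hessianForm_tangent_of_const`); its trace is a
component of the mean curvature of the fiber, hence zero. `metricTrace_hessianForm_comp` assembles
the two blocks, and surjectivity of `π` transfers the pointwise conditions between `M` and `B`. -/

/-! ### Metric traces and orthogonal decompositions. -/

section LinearAlgebra

variable {V V₁ V₂ : Type*} [AddCommGroup V] [Module ℝ V] [FiniteDimensional ℝ V]
  [AddCommGroup V₁] [Module ℝ V₁] [FiniteDimensional ℝ V₁]
  [AddCommGroup V₂] [Module ℝ V₂] [FiniteDimensional ℝ V₂]

/-- A change of basis `P` turns the Gram matrices into `Pᵀ Γ P` and `Pᵀ B P`, so `Γ⁻¹ B` is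
conjugated by `P` and keeps its trace. Degenerate `γ` is allowed, since `Matrix.mul_inv_rev` holds
for singular matrices too. -/
theorem metricTrace_eq_trace_basis {ι : Type*} [Fintype ι] [DecidableEq ι]
    (e : Module.Basis ι ℝ V) (γ β : V →ₗ[ℝ] V →ₗ[ℝ] ℝ) :
    metricTrace (fun v w => γ v w) (fun v w => β v w) =
      ((Matrix.of fun i j => γ (e i) (e j))⁻¹ * Matrix.of fun i j => β (e i) (e j)).trace := by
  have same : ∀ (e' : Module.Basis ι ℝ V),
      ((Matrix.of fun i j => γ (e' i) (e' j))⁻¹ *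
        Matrix.of fun i j => β (e' i) (e' j)).trace =
      ((Matrix.of fun i j => γ (e i) (e j))⁻¹ * Matrix.of fun i j => β (e i) (e j)).trace := by
    intro e'
    set P : Matrix ι ι ℝ := e.toMatrix e' with hPdef
    have hP : IsUnit P.det := by
      rw [← Matrix.isUnit_iff_isUnit_det]
      have := e.invertibleToMatrix e'
      exact isUnit_of_invertible P
    have change : ∀ α : V →ₗ[ℝ] V →ₗ[ℝ] ℝ, (Matrix.of fun i j => α (e' i) (e' j)) =
        P.transpose * (Matrix.of fun i j => α (e i) (e j)) * P := by
      intro α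
      have h := LinearMap.BilinForm.toMatrix_mul_basis_toMatrix (b := e) (c := e') α
      have h' : ∀ b : Module.Basis ι ℝ V,
          LinearMap.BilinForm.toMatrix b α = Matrix.of fun i j => α (b i) (b j) := by
        intro b
        ext i j
        simp [LinearMap.BilinForm.toMatrix_apply]
      rw [h', h'] at h
      exact h.symm
    have hPt : IsUnit P.transpose.det := by rwa [Matrix.det_transpose]
    rw [change γ, change β, Matrix.mul_inv_rev, Matrix.mul_inv_rev]
    calc _ = (P⁻¹ * ((Matrix.of fun i j => γ (e i) (e j))⁻¹ *
          (P.transpose⁻¹ * P.transpose) * (Matrix.of fun i j => β (e i) (e j)) * P)).trace := by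
          simp only [Matrix.mul_assoc]
      _ = _ := by
          rw [Matrix.nonsing_inv_mul _ hPt, Matrix.mul_one, Matrix.trace_mul_comm,
            Matrix.mul_assoc, Matrix.mul_nonsing_inv _ hP, Matrix.mul_one]
  -- The conjugation argument needs both bases on the same index type, so the chosen basis is
  -- reindexed by `ι`.
  set σ : ι ≃ Fin (Module.finrank ℝ V) := e.indexEquiv (Module.finBasis ℝ V)
  rw [← same ((Module.finBasis ℝ V).reindex σ.symm)]
  have hsub : ∀ α : V →ₗ[ℝ] V →ₗ[ℝ] ℝ,
      (Matrix.of fun i j => α (((Module.finBasis ℝ V).reindex σ.symm) i)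
        (((Module.finBasis ℝ V).reindex σ.symm) j)) =
      (Matrix.of fun i j => α (Module.finBasis ℝ V i) (Module.finBasis ℝ V j)).submatrix σ σ := by
    intro α
    ext i j
    simp
  rw [hsub, hsub, Matrix.inv_submatrix_equiv, Matrix.submatrix_mul_equiv]
  simp only [metricTrace, Matrix.trace, Matrix.diag_apply, Matrix.submatrix_apply]
  exact (Equiv.sum_comp σ _).symm

theorem metricTrace_smul (γ β : V → V → ℝ) (c : ℝ) :
    metricTrace γ (fun v w => c * β v w) = c * metricTrace γ β := by
  have h : (Matrix.of fun i j => c * β (Module.finBasis ℝ V i) (Module.finBasis ℝ V j)) =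
      c • Matrix.of fun i j => β (Module.finBasis ℝ V i) (Module.finBasis ℝ V j) := rfl
  simp only [metricTrace]
  rw [h, Matrix.mul_smul, Matrix.trace_smul, smul_eq_mul]

omit [FiniteDimensional ℝ V] in
-- A vector in the left kernel of the Gram matrix is the coordinate vector of an element orthogonal
-- to everything.
theorem isUnit_gramMatrix {ι : Type*} [Fintype ι] [DecidableEq ι]
    (e : Module.Basis ι ℝ V) (γ : V →ₗ[ℝ] V →ₗ[ℝ] ℝ) (hγ : ∀ v, (∀ w, γ v w = 0) → v = 0) :
    IsUnit (Matrix.of fun i j => γ (e i) (e j)) := by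
  rw [Matrix.isUnit_iff_isUnit_det, isUnit_iff_ne_zero]
  intro h0
  obtain ⟨c, hc, hc0⟩ := Matrix.exists_vecMul_eq_zero_iff.2 h0
  apply hc
  have hv : (∑ i, c i • e i) = 0 := by
    apply hγ
    intro w
    have hlin : γ (∑ i, c i • e i) = 0 := by
      apply e.ext
      intro j
      have := congrFun hc0 j
      simpa [Matrix.vecMul, dotProduct] using this
    simp [hlin]
  ext i
  exact Fintype.linearIndependent_iff.1 e.linearIndependent c hv i

/-- The metric trace is additive along an orthogonal decomposition. -/
theorem metricTrace_eq_add_of_orthogonal (γ β : V →ₗ[ℝ] V →ₗ[ℝ] ℝ) (e : (V₁ × V₂) ≃ₗ[ℝ] V)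
    (h₁₂ : ∀ a b, γ (e (a, 0)) (e (0, b)) = 0) (h₂₁ : ∀ a b, γ (e (0, b)) (e (a, 0)) = 0)
    (h₁ : ∀ a, (∀ a', γ (e (a, 0)) (e (a', 0)) = 0) → a = 0)
    (h₂ : ∀ b, (∀ b', γ (e (0, b)) (e (0, b')) = 0) → b = 0) :
    metricTrace (fun v w => γ v w) (fun v w => β v w) =
      metricTrace (fun a a' : V₁ => γ (e (a, 0)) (e (a', 0)))
        (fun a a' => β (e (a, 0)) (e (a', 0))) +
      metricTrace (fun b b' : V₂ => γ (e (0, b)) (e (0, b')))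
        (fun b b' => β (e (0, b)) (e (0, b'))) := by
  set i₁ : V₁ →ₗ[ℝ] V := e.toLinearMap ∘ₗ LinearMap.inl ℝ V₁ V₂
  set i₂ : V₂ →ₗ[ℝ] V := e.toLinearMap ∘ₗ LinearMap.inr ℝ V₁ V₂
  set b₁ := Module.finBasis ℝ V₁
  set b₂ := Module.finBasis ℝ V₂
  have t₁ := metricTrace_eq_trace_basis b₁ (γ.compl₁₂ i₁ i₁) (β.compl₁₂ i₁ i₁)
  have t₂ := metricTrace_eq_trace_basis b₂ (γ.compl₁₂ i₂ i₂) (β.compl₁₂ i₂ i₂)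
  have u₁ := isUnit_gramMatrix b₁ (γ.compl₁₂ i₁ i₁) h₁
  have u₂ := isUnit_gramMatrix b₂ (γ.compl₁₂ i₂ i₂) h₂
  have t := metricTrace_eq_trace_basis ((b₁.prod b₂).map e) γ β
  have hγ : (Matrix.of fun i j => γ (((b₁.prod b₂).map e) i) (((b₁.prod b₂).map e) j)) =
      Matrix.fromBlocks (Matrix.of fun i j => γ.compl₁₂ i₁ i₁ (b₁ i) (b₁ j)) 0 0
        (Matrix.of fun i j => γ.compl₁₂ i₂ i₂ (b₂ i) (b₂ j)) := by
    ext i j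
    rcases i with i | i <;> rcases j with j | j <;>
      simp [i₁, i₂, h₁₂, h₂₁]
  have hβ : (Matrix.of fun i j => β (((b₁.prod b₂).map e) i) (((b₁.prod b₂).map e) j)) =
      Matrix.fromBlocks (Matrix.of fun i j => β.compl₁₂ i₁ i₁ (b₁ i) (b₁ j))
        (Matrix.of fun i j => β (i₁ (b₁ i)) (i₂ (b₂ j)))
        (Matrix.of fun i j => β (i₂ (b₂ i)) (i₁ (b₁ j)))
        (Matrix.of fun i j => β.compl₁₂ i₂ i₂ (b₂ i) (b₂ j)) := by
    ext i j
    rcases i with i | i <;> rcases j with j | j <;> simp [i₁, i₂]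
  -- Both blocks must be invertible: if only one were singular, the inverse of the whole Gram matrix
  -- would be zero by convention and the contribution of the other block would be lost. The
  -- off-diagonal blocks of `β` do not reach the trace.
  rw [hγ, hβ, Matrix.inv_fromBlocks_zero₂₁_of_isUnit_iff _ _ _ ⟨fun _ => u₂, fun _ => u₁⟩,
    Matrix.fromBlocks_multiply] at t
  simp only [Matrix.mul_zero, Matrix.zero_mul, neg_zero, add_zero, zero_add] at t
  rw [t]
  simp only [Matrix.trace, Fintype.sum_sum_type, Matrix.diag_apply, Matrix.fromBlocks_apply₁₁,
    Matrix.fromBlocks_apply₂₂]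
  exact congrArg₂ _ t₁.symm t₂.symm

/-- Orthogonal projection to a nondegenerate subspace. -/
theorem exists_mem_ker_sub_orthogonal {W : Type*} [AddCommGroup W] [Module ℝ W]
    (g : V →ₗ[ℝ] V →ₗ[ℝ] ℝ) (hsymm : ∀ v w, g v w = g w v) (P : V →ₗ[ℝ] W)
    (hnd : ∀ v, P v = 0 → (∀ w, P w = 0 → g v w = 0) → v = 0) (v : V) :
    ∃ z, P z = 0 ∧ ∀ w, P w = 0 → g (v - z) w = 0 := by
  have hrefl : LinearMap.BilinForm.IsRefl g := fun x y h => by rw [hsymm, h]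
  have hcompl : IsCompl (LinearMap.ker P) (LinearMap.BilinForm.orthogonal g (LinearMap.ker P)) := by
    rw [LinearMap.BilinForm.isCompl_orthogonal_iff_disjoint hrefl, Submodule.disjoint_def]
    intro x hx hx'
    refine hnd x (by simpa using hx) fun w hw => ?_
    rw [hsymm]
    exact LinearMap.BilinForm.mem_orthogonal_iff.1 hx' w (by simpa using hw)
  obtain ⟨z, hz, y, hy, rfl⟩ := Submodule.mem_sup.1
    (hcompl.sup_eq_top ▸ Submodule.mem_top : v ∈ _ ⊔ _)
  refine ⟨z, by simpa using hz, fun w hw => ?_⟩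
  rw [add_sub_cancel_left, hsymm]
  exact LinearMap.BilinForm.mem_orthogonal_iff.1 hy w (by simpa using hw)

end LinearAlgebra

/-! ### Second derivatives, pullbacks of metrics and Christoffel symbols in Euclidean coordinates.
-/

section Calculus

open Topology Filter

variable {E F G : Type*} [NormedAddCommGroup E] [NormedSpace ℝ E]
  [NormedAddCommGroup F] [NormedSpace ℝ F] [NormedAddCommGroup G] [NormedSpace ℝ G]

theorem ContDiffAt.differentiableAt_fderiv {f : E → F} {x : E} (hf : ContDiffAt ℝ 2 f x) :
    DifferentiableAt ℝ (fderiv ℝ f) x :=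
  (hf.fderiv_right (m := 1) (by norm_num)).differentiableAt (by norm_num)

theorem fderiv_fderiv_comp_apply {f : F → G} {p : E → F} {x : E}
    (hf : ContDiffAt ℝ 2 f (p x)) (hp : ContDiffAt ℝ 2 p x) (a b : E) :
    fderiv ℝ (fderiv ℝ (f ∘ p)) x a b =
      fderiv ℝ (fderiv ℝ f) (p x) (fderiv ℝ p x a) (fderiv ℝ p x b) +
        fderiv ℝ f (p x) (fderiv ℝ (fderiv ℝ p) x a b) := by
  have hev : fderiv ℝ (f ∘ p) =ᶠ[𝓝 x] fun y => (fderiv ℝ f (p y)).comp (fderiv ℝ p y) := by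
    have h1 : ∀ᶠ y in 𝓝 x, DifferentiableAt ℝ p y :=
      (hp.eventually (by simp)).mono fun y hy => hy.differentiableAt (by norm_num)
    have h2 : ∀ᶠ y in 𝓝 x, DifferentiableAt ℝ f (p y) :=
      hp.continuousAt.eventually
        ((hf.eventually (by simp)).mono fun y hy => hy.differentiableAt (by norm_num))
    filter_upwards [h1, h2] with y hy1 hy2
    exact fderiv_comp y hy2 hy1
  have hpd : DifferentiableAt ℝ p x := hp.differentiableAt (by norm_num)
  have hd1 : HasFDerivAt (fun y => fderiv ℝ f (p y))
      ((fderiv ℝ (fderiv ℝ f) (p x)).comp (fderiv ℝ p x)) x :=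
    hf.differentiableAt_fderiv.hasFDerivAt.comp x hpd.hasFDerivAt
  have hd2 := hp.differentiableAt_fderiv.hasFDerivAt
  rw [hev.fderiv_eq, (hd1.clm_comp hd2).fderiv]
  simp [add_comm]

theorem fderiv_bilin_apply {T : E → F →L[ℝ] G →L[ℝ] ℝ} {x : E} (hT : DifferentiableAt ℝ T x)
    (a : E) (b : F) (c : G) :
    fderiv ℝ T x a b c = fderiv ℝ (fun y => T y b c) x a := by
  have h := (hT.hasFDerivAt.clm_apply (hasFDerivAt_const b x)).clm_apply (hasFDerivAt_const c x)
  rw [h.fderiv]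
  simp

theorem differentiable_flip :
    Differentiable ℝ (fun B : G →L[ℝ] F →L[ℝ] ℝ => B.flip) :=
  ContinuousLinearMap.differentiable (F := F →L[ℝ] G →L[ℝ] ℝ)
    ((ContinuousLinearMap.flipₗᵢ ℝ G F ℝ).toContinuousLinearEquiv :
      (G →L[ℝ] F →L[ℝ] ℝ) →L[ℝ] (F →L[ℝ] G →L[ℝ] ℝ))

theorem DifferentiableAt.bilinearComp {Q : E → F →L[ℝ] F →L[ℝ] ℝ} {A : E → G →L[ℝ] F} {x : E}
    (hQ : DifferentiableAt ℝ Q x) (hA : DifferentiableAt ℝ A x) :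
    DifferentiableAt ℝ (fun y => (Q y).bilinearComp (A y) (A y)) x := by
  have h1 : DifferentiableAt ℝ (fun y => ((Q y).comp (A y)).flip) x :=
    DifferentiableAt.comp (𝕜 := ℝ) (F := G →L[ℝ] F →L[ℝ] ℝ) (G := F →L[ℝ] G →L[ℝ] ℝ)
      (f := fun y => (Q y).comp (A y)) (g := fun B => B.flip) x (differentiable_flip _)
      (hQ.clm_comp hA)
  exact DifferentiableAt.comp (𝕜 := ℝ) (F := G →L[ℝ] G →L[ℝ] ℝ) (G := G →L[ℝ] G →L[ℝ] ℝ)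
    (f := fun y => ((Q y).comp (A y)).flip.comp (A y)) (g := fun B => B.flip) x
    (differentiable_flip _) (h1.clm_comp hA)

theorem fderiv_pullback_apply {Q : F → F →L[ℝ] F →L[ℝ] ℝ} {p : E → F} {x : E}
    (hQ : DifferentiableAt ℝ Q (p x)) (hp : ContDiffAt ℝ 2 p x) (a b c : E) :
    fderiv ℝ (fun y => (Q (p y)).bilinearComp (fderiv ℝ p y) (fderiv ℝ p y)) x a b c =
      fderiv ℝ Q (p x) (fderiv ℝ p x a) (fderiv ℝ p x b) (fderiv ℝ p x c) +
        Q (p x) (fderiv ℝ (fderiv ℝ p) x a b) (fderiv ℝ p x c) +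
        Q (p x) (fderiv ℝ p x b) (fderiv ℝ (fderiv ℝ p) x a c) := by
  have hpd : DifferentiableAt ℝ p x := hp.differentiableAt (by norm_num)
  have hd1 : HasFDerivAt (fun y => Q (p y)) ((fderiv ℝ Q (p x)).comp (fderiv ℝ p x)) x :=
    HasFDerivAt.comp (G := F →L[ℝ] F →L[ℝ] ℝ) (g := Q) x hQ.hasFDerivAt hpd.hasFDerivAt
  have hd2 := hp.differentiableAt_fderiv
  have hd3 := (hd1.clm_apply (hd2.hasFDerivAt.clm_apply (hasFDerivAt_const b x))).clm_apply
    (hd2.hasFDerivAt.clm_apply (hasFDerivAt_const c x))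
  rw [fderiv_bilin_apply (DifferentiableAt.bilinearComp hd1.differentiableAt hd2)]
  simp only [ContinuousLinearMap.bilinearComp_apply]
  rw [hd3.fderiv]
  simp
  ring

/-- A vector orthogonal to the kernel of `dp` extends to a differentiable field of such vectors. -/
theorem exists_horizontal_extension [FiniteDimensional ℝ E]
    {T : E → E →L[ℝ] E →L[ℝ] ℝ} {A : E → E →L[ℝ] F} {x : E}
    (hT : DifferentiableAt ℝ T x) (hA : DifferentiableAt ℝ A x)
    (hnd : ∀ v, (∀ w, T x v w = 0) → v = 0) (c : E) (β : F →L[ℝ] ℝ)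
    (hβ : ∀ w, T x c w = β (A x w)) :
    ∃ X : E → E, DifferentiableAt ℝ X x ∧ X x = c ∧
      ∀ᶠ y in 𝓝 x, ∀ w, T y (X y) w = β (A y w) := by
  have hinj : Function.Injective (T x) := by
    rw [injective_iff_map_eq_zero]
    intro v hv
    exact hnd v fun w => by simp [hv]
  have hfr : Module.finrank ℝ E = Module.finrank ℝ (E →L[ℝ] ℝ) := by
    rw [← LinearMap.toContinuousLinearMap.finrank_eq (R := ℝ) (M := E →ₗ[ℝ] ℝ)]
    exact (Subspace.dual_finrank_eq (K := ℝ) (V := E)).symm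
  set e : E ≃L[ℝ] (E →L[ℝ] ℝ) :=
    (LinearEquiv.ofInjectiveOfFinrankEq (T x).toLinearMap hinj hfr).toContinuousLinearEquiv
  have he : (e : E →L[ℝ] (E →L[ℝ] ℝ)) = T x := by ext v; rfl
  have hinv : DifferentiableAt ℝ (fun y => ContinuousLinearMap.inverse (T y)) x := by
    have h1 : DifferentiableAt ℝ (ContinuousLinearMap.inverse :
        (E →L[ℝ] (E →L[ℝ] ℝ)) → _) (T x) := by
      rw [← he]
      exact (contDiffAt_map_inverse (n := 1) e).differentiableAt (by norm_num)
    exact DifferentiableAt.comp (𝕜 := ℝ) (F := E →L[ℝ] E →L[ℝ] ℝ)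
      (G := (E →L[ℝ] ℝ) →L[ℝ] E) (f := T) (g := ContinuousLinearMap.inverse) x h1 hT
  have hβA : DifferentiableAt ℝ (fun y => β.comp (A y)) x := (differentiableAt_const β).clm_comp hA
  -- `T x` is an isomorphism onto the dual, so `X y` can be obtained by solving `T y (X y) = β ∘ A
  -- y`; inversion is differentiable at an isomorphism.
  refine ⟨fun y => ContinuousLinearMap.inverse (T y) (β.comp (A y)), hinv.clm_apply hβA, ?_, ?_⟩
  · have h2 : β.comp (A x) = T x c := by ext w; exact (hβ w).symm
    simp only
    rw [h2, ← he, ContinuousLinearMap.inverse_equiv]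
    simp
  -- Isomorphisms form an open set, so the inverse is genuine near `x`; elsewhere
  -- `ContinuousLinearMap.inverse` is zero.
  · have hnear : ∀ᶠ y in 𝓝 x, T y ∈ Set.range
        ((↑) : (E ≃L[ℝ] (E →L[ℝ] ℝ)) → E →L[ℝ] (E →L[ℝ] ℝ)) :=
      hT.continuousAt.eventually (he ▸ ContinuousLinearEquiv.nhds e)
    filter_upwards [hnear] with y hy w
    obtain ⟨e', he'⟩ := hy
    rw [← he', ContinuousLinearMap.inverse_equiv]
    simp

/-- If `p` is isometric on vectors orthogonal to the kernel of `dp`, then the Christoffel symbols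
of the first kind of the two metrics agree on such vectors, up to the second derivative of `p`. -/
theorem christoffel_horizontal [FiniteDimensional ℝ E]
    {T : E → E →L[ℝ] E →L[ℝ] ℝ} {Q : F → F →L[ℝ] F →L[ℝ] ℝ} {p : E → F} {x : E}
    (hT : DifferentiableAt ℝ T x) (hQ : DifferentiableAt ℝ Q (p x)) (hp : ContDiffAt ℝ 2 p x)
    (hTsymm : ∀ v w, T x v w = T x w v) (hQsymm : ∀ v w, Q (p x) v w = Q (p x) w v)
    (hnd : ∀ v, (∀ w, T x v w = 0) → v = 0)
    (hiso : ∀ᶠ y in 𝓝 x, ∀ v, (∀ z, fderiv ℝ p y z = 0 → T y v z = 0) →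
      ∀ w, Q (p y) (fderiv ℝ p y v) (fderiv ℝ p y w) = T y v w)
    {a b c : E} (ha : ∀ z, fderiv ℝ p x z = 0 → T x a z = 0)
    (hb : ∀ z, fderiv ℝ p x z = 0 → T x b z = 0) (hc : ∀ z, fderiv ℝ p x z = 0 → T x c z = 0) :
    (1 / 2 : ℝ) * (fderiv ℝ T x a b c + fderiv ℝ T x b a c - fderiv ℝ T x c a b) =
      Q (p x) (fderiv ℝ (fderiv ℝ p) x a b) (fderiv ℝ p x c) +
      (1 / 2 : ℝ) * (fderiv ℝ Q (p x) (fderiv ℝ p x a) (fderiv ℝ p x b) (fderiv ℝ p x c) +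
        fderiv ℝ Q (p x) (fderiv ℝ p x b) (fderiv ℝ p x a) (fderiv ℝ p x c) -
        fderiv ℝ Q (p x) (fderiv ℝ p x c) (fderiv ℝ p x a) (fderiv ℝ p x b)) := by
  have hA := hp.differentiableAt_fderiv
  have hQp : DifferentiableAt ℝ (fun y => Q (p y)) x :=
    DifferentiableAt.comp (G := F →L[ℝ] F →L[ℝ] ℝ) (g := Q) x hQ (hp.differentiableAt (by norm_num))
  have hP := DifferentiableAt.bilinearComp hQp hA
  -- Put `S = T - p^*Q` and extend `v` to a horizontal field `X`. Then `S (X, w) = 0` near `x`, and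
  -- differentiating along `d` gives `dS (d) (v, w) + S (dX d, w) = 0`. The last term vanishes
  -- because `w` is horizontal at `x`, so the first derivatives of the two forms agree on horizontal
  -- pairs. The direction `d` is arbitrary.
  have key : ∀ d v w, (∀ z, fderiv ℝ p x z = 0 → T x v z = 0) →
      (∀ z, fderiv ℝ p x z = 0 → T x w z = 0) →
      fderiv ℝ T x d v w =
        fderiv ℝ (fun y => (Q (p y)).bilinearComp (fderiv ℝ p y) (fderiv ℝ p y)) x d v w := by
    intro d v w hv hw
    have hisox := hiso.self_of_nhds
    obtain ⟨X, hX, hXx, hXe⟩ := exists_horizontal_extension hT hA hnd v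
      (Q (p x) (fderiv ℝ p x v)) (fun w => (hisox v hv w).symm)
    have hz : (fun y => T y (X y) w) =ᶠ[𝓝 x]
        fun y => (Q (p y)).bilinearComp (fderiv ℝ p y) (fderiv ℝ p y) (X y) w := by
      filter_upwards [hiso, hXe] with y hy hXy
      refine (hy (X y) (fun z hz => ?_) w).symm
      rw [hXy, hz, map_zero]
    have e1 := ((hT.hasFDerivAt.clm_apply hX.hasFDerivAt).clm_apply (hasFDerivAt_const w x)).fderiv
    have e2 := ((hP.hasFDerivAt.clm_apply hX.hasFDerivAt).clm_apply (hasFDerivAt_const w x)).fderiv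
    have e3 := DFunLike.congr_fun (e1.symm.trans (hz.fderiv_eq.trans e2)) d
    have e4 : T x (fderiv ℝ X x d) w =
        Q (p x) (fderiv ℝ p x (fderiv ℝ X x d)) (fderiv ℝ p x w) := by
      rw [hTsymm, hQsymm, hisox w hw]
    simpa [hXx, e4] using e3
  -- Six terms with `D²p` appear; by the symmetry of `D²p` and `Q` four cancel and the other two,
  -- halved, leave `Q (D²p (a, b), dp c)`.
  have hs := (hp.isSymmSndFDerivAt (by simp)).eq
  rw [key a b c hb hc, key b a c ha hc, key c a b ha hb, fderiv_pullback_apply hQ hp,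
    fderiv_pullback_apply hQ hp, fderiv_pullback_apply hQ hp, hs b a, hs c a, hs c b,
    hQsymm (fderiv ℝ p x a) (fderiv ℝ (fderiv ℝ p) x b c),
    hQsymm (fderiv ℝ p x b) (fderiv ℝ (fderiv ℝ p) x a c)]
  ring

end Calculus

/-! ### Coordinate expressions of metrics and maps. -/

section ChartCalculus

open Topology Filter

variable {E H : Type*} [NormedAddCommGroup E] [NormedSpace ℝ E] [TopologicalSpace H]
  {I : ModelWithCorners ℝ E H} {M : Type*} [TopologicalSpace M] [ChartedSpace H M]

theorem chartMetric_self [IsManifold I 1 M] (g : TangentBilinField I M) (x : M) (v w : E) :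
    chartMetric I g x (extChartAt I x x) v w = g x v w := by
  have hg : ∀ q : M, q = x → ∀ a b : E, (g q : E →L[ℝ] E →L[ℝ] ℝ) a b = g x a b := by
    rintro q rfl a b; rfl
  have hA : (mfderivWithin 𝓘(ℝ, E) I (extChartAt I x).symm (range I) (extChartAt I x x) :
      E →L[ℝ] E) = ContinuousLinearMap.id ℝ E := mfderivWithin_range_extChartAt_symm
  unfold chartMetric
  simp only [hA]
  exact hg _ (extChartAt_to_inv x) v w

/-- Smoothness of `g` is expressed in the trivialization of the tangent bundle at `x`, whose inverse
on fibers is the differential of the inverse chart. The trivialized form is therefore `chartMetric`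
near the base point. -/
theorem differentiableAt_chartMetric [FiniteDimensional ℝ E] [I.Boundaryless] [IsManifold I ∞ M]
    {g : TangentBilinField I M} (hg : IsSemiRiemannianMetric I g) (x : M) :
    DifferentiableAt ℝ (chartMetric I g x) (extChartAt I x x) := by
  have : IsManifold I 1 M := IsManifold.of_le (n := ∞) (by simp)
  have : IsManifold I (∞ + 1) M := by simpa
  have h := ((contMDiffAt_hom_bundle _).1 (hg.smooth x)).2
  have h2 := (contMDiffAt_iff.1 h).2
  rw [I.range_eq_univ, contDiffWithinAt_univ] at h2
  refine (h2.differentiableAt (by simp)).congr_of_eventuallyEq ?_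
  filter_upwards [extChartAt_target_mem_nhds (I := I) x] with y hy
  have hy' : (extChartAt I x).symm y ∈ (chartAt H x).source := by
    rw [← extChartAt_source I]; exact (extChartAt I x).map_target hy
  ext v w
  simp only [Function.comp_def, extChartAt_model_space_eq_id, PartialEquiv.refl_coe, id]
  rw [inCoordinates_apply_eq₂ (by simpa) (by simpa) (by simp)]
  have hs := TangentBundle.symmL_trivializationAt (I := I) hy'
  rw [(extChartAt I x).right_inv hy] at hs
  have hs' : ∀ v : E, (trivializationAt E (TangentSpace I) x).symm ((extChartAt I x).symm y) v =
    mfderivWithin 𝓘(ℝ, E) I (extChartAt I x).symm (range I) y v := fun v => by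
      rw [← hs]; exact (Bundle.Trivialization.symmL_apply _ (by simpa) _).symm
  rw [hs', hs']
  simp [chartMetric]
  rfl

theorem christoffelFirst_eq [I.Boundaryless] (g : TangentBilinField I M) (x : M) (u v w : E) :
    christoffelFirst I g x u v w = (1 / 2) *
      (fderiv ℝ (chartMetric I g x) (extChartAt I x x) u v w +
        fderiv ℝ (chartMetric I g x) (extChartAt I x x) v u w -
        fderiv ℝ (chartMetric I g x) (extChartAt I x x) w u v) := by
  simp [christoffelFirst, I.range_eq_univ]

variable {E' H' : Type*} [NormedAddCommGroup E'] [NormedSpace ℝ E'] [TopologicalSpace H']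
  {J : ModelWithCorners ℝ E' H'} {N : Type*} [TopologicalSpace N] [ChartedSpace H' N]

theorem contDiffAt_writtenInExtChartAt [I.Boundaryless] {n : WithTop ℕ∞} {f : M → N} {x : M}
    (hf : ContMDiffAt I J n f x) :
    ContDiffAt ℝ n (writtenInExtChartAt I J x f) (extChartAt I x x) := by
  have h := (contMDiffAt_iff.1 hf).2
  rwa [I.range_eq_univ, contDiffWithinAt_univ] at h

theorem mfderiv_eq_fderiv_writtenInExtChartAt [I.Boundaryless] {f : M → N} {x : M}
    (hf : MDifferentiableAt I J f x) (v : E) :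
    mfderiv I J f x v = fderiv ℝ (writtenInExtChartAt I J x f) (extChartAt I x x) v := by
  rw [hf.mfderiv, I.range_eq_univ, fderivWithin_univ]
  rfl

theorem productMetric_apply (g : TangentBilinField I M) (ε : ℝ) (p : M × ℝ) (v w : E × ℝ) :
    productMetric I g ε p v w = g p.1 v.1 w.1 + ε * (v.2 * w.2) := rfl

variable [I.Boundaryless] [IsManifold I 1 M]

/-- The chart of `M × ℝ` is the chart of `M` times the identity, so the differential of its inverse
acts blockwise. Equality on a neighborhood, not just at the point, is what differentiation requires.
-/
theorem chartMetric_productMetric (g : TangentBilinField I M) (ε : ℝ) (x : M) (t : ℝ) :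
    ∀ᶠ z in 𝓝 (extChartAt (I.prod 𝓘(ℝ, ℝ)) (x, t) (x, t)), ∀ v w : E × ℝ,
      chartMetric (I.prod 𝓘(ℝ, ℝ)) (productMetric I g ε) (x, t) z v w =
        chartMetric I g x z.1 v.1 w.1 + ε * (v.2 * w.2) := by
  have hmem : ∀ᶠ z : E × ℝ in 𝓝 (extChartAt (I.prod 𝓘(ℝ, ℝ)) (x, t) (x, t)),
      z.1 ∈ (extChartAt I x).target := by
    have : Tendsto (fun z : E × ℝ => z.1) (𝓝 (extChartAt (I.prod 𝓘(ℝ, ℝ)) (x, t) (x, t)))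
        (𝓝 (extChartAt I x x)) := by
      simpa [extChartAt_prod] using continuous_fst.tendsto
        (extChartAt (I.prod 𝓘(ℝ, ℝ)) (x, t) (x, t))
    exact this.eventually (extChartAt_target_mem_nhds x)
  filter_upwards [hmem] with z hz v w
  have hd : MDifferentiableAt 𝓘(ℝ, E) I (extChartAt I x).symm z.1 := by
    have := mdifferentiableWithinAt_extChartAt_symm (I := I) hz
    rwa [I.range_eq_univ, mdifferentiableWithinAt_univ] at this
  have hfst : MDifferentiableAt 𝓘(ℝ, E × ℝ) 𝓘(ℝ, E) (fun z : E × ℝ => z.1) z :=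
    differentiableAt_fst.mdifferentiableAt
  have hsnd : MDifferentiableAt 𝓘(ℝ, E × ℝ) 𝓘(ℝ, ℝ) (fun z : E × ℝ => z.2) z :=
    differentiableAt_snd.mdifferentiableAt
  have hfun : ((extChartAt (I.prod 𝓘(ℝ, ℝ)) (x, t)).symm : E × ℝ → M × ℝ) =
      fun z => ((extChartAt I x).symm z.1, z.2) := by
    funext z
    rw [extChartAt_prod]
    rfl
  have hD : ∀ v : E × ℝ, (mfderivWithin 𝓘(ℝ, E × ℝ) (I.prod 𝓘(ℝ, ℝ))
      (extChartAt (I.prod 𝓘(ℝ, ℝ)) (x, t)).symm (range (I.prod 𝓘(ℝ, ℝ))) z v : E × ℝ) =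
      ((mfderivWithin 𝓘(ℝ, E) I (extChartAt I x).symm (range I) z.1 v.1 : E), v.2) := by
    intro v
    have h1 := hd.hasMFDerivAt.comp z hfst.hasMFDerivAt
    have h2 := (h1.prodMk hsnd.hasMFDerivAt).mfderiv
    rw [(I.prod 𝓘(ℝ, ℝ)).range_eq_univ, I.range_eq_univ, mfderivWithin_univ, mfderivWithin_univ,
      hfun]
    refine (congrArg (fun L : (E × ℝ) →L[ℝ] (E × ℝ) => L v) h2).trans ?_
    rw [mfderiv_eq_fderiv, mfderiv_eq_fderiv, fderiv_fst, fderiv_snd]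
    rfl
  have hp : ((extChartAt (I.prod 𝓘(ℝ, ℝ)) (x, t)).symm z).1 = (extChartAt I x).symm z.1 := by
    rw [hfun]
  have hg : ∀ q q' : M, q = q' → ∀ a b : E, (g q : E →L[ℝ] E →L[ℝ] ℝ) a b = g q' a b := by
    rintro q _ rfl a b; rfl
  change productMetric I g ε _ (mfderivWithin 𝓘(ℝ, E × ℝ) (I.prod 𝓘(ℝ, ℝ))
      (extChartAt (I.prod 𝓘(ℝ, ℝ)) (x, t)).symm (range (I.prod 𝓘(ℝ, ℝ))) z v : E × ℝ)
      (mfderivWithin 𝓘(ℝ, E × ℝ) (I.prod 𝓘(ℝ, ℝ))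
      (extChartAt (I.prod 𝓘(ℝ, ℝ)) (x, t)).symm (range (I.prod 𝓘(ℝ, ℝ))) z w : E × ℝ) = _
  refine (congrArg₂ (fun a b : E × ℝ => (productMetric I g ε _ :
    (E × ℝ) →L[ℝ] (E × ℝ) →L[ℝ] ℝ) a b) (hD v) (hD w)).trans ?_
  refine (productMetric_apply g ε _ _ _).trans ?_
  exact congrArg (· + _) (hg _ _ hp _ _)

end ChartCalculus

/-! ### Second fundamental form of a graph. -/

section GraphGeometry

open Topology Filter

variable {E H : Type*} [NormedAddCommGroup E] [NormedSpace ℝ E] [FiniteDimensional ℝ E]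
  [TopologicalSpace H]
  {I : ModelWithCorners ℝ E H} [I.Boundaryless]
  {M : Type*} [TopologicalSpace M] [ChartedSpace H M] [IsManifold I ∞ M]

/-- The block `ε dt²` has constant coefficients and the other block does not depend on `t`, so only
derivatives of `g` along `M` survive. -/
theorem christoffelFirst_productMetric {g : TangentBilinField I M}
    (hg : IsSemiRiemannianMetric I g) (ε : ℝ) (x : M) (t : ℝ) (u v w : E × ℝ) :
    christoffelFirst (I.prod 𝓘(ℝ, ℝ)) (productMetric I g ε) (x, t) u v w =
      christoffelFirst I g x u.1 v.1 w.1 := by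
  have : IsManifold I 1 M := IsManifold.of_le (n := ∞) (by simp)
  set P : E × ℝ → (E × ℝ) →L[ℝ] (E × ℝ) →L[ℝ] ℝ :=
    fun z => (chartMetric I g x z.1).bilinearComp (ContinuousLinearMap.fst ℝ E ℝ)
      (ContinuousLinearMap.fst ℝ E ℝ) +
    ε • (ContinuousLinearMap.mul ℝ ℝ).bilinearComp
      (ContinuousLinearMap.snd ℝ E ℝ) (ContinuousLinearMap.snd ℝ E ℝ) with hP
  have hpt : extChartAt (I.prod 𝓘(ℝ, ℝ)) (x, t) (x, t) = (extChartAt I x x, t) := by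
    rw [extChartAt_prod]; rfl
  have hev : chartMetric (I.prod 𝓘(ℝ, ℝ)) (productMetric I g ε) (x, t)
      =ᶠ[𝓝 (extChartAt I x x, t)] P := by
    have h := chartMetric_productMetric (I := I) g ε x t
    rw [hpt] at h
    filter_upwards [h] with z hz
    exact ContinuousLinearMap.ext fun v => ContinuousLinearMap.ext fun w => hz v w
  have hG : DifferentiableAt ℝ (fun z : E × ℝ => chartMetric I g x z.1) (extChartAt I x x, t) :=
    DifferentiableAt.comp (𝕜 := ℝ) (G := E →L[ℝ] E →L[ℝ] ℝ) (g := chartMetric I g x)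
      (f := Prod.fst) (extChartAt I x x, t) (differentiableAt_chartMetric hg x) differentiableAt_fst
  have hPd : DifferentiableAt ℝ P (extChartAt I x x, t) :=
    DifferentiableAt.add (𝕜 := ℝ) (F := (E × ℝ) →L[ℝ] (E × ℝ) →L[ℝ] ℝ)
      (DifferentiableAt.bilinearComp hG (differentiableAt_const _)) (differentiableAt_const _)
  have key : ∀ a b c : E × ℝ,
      fderiv ℝ (chartMetric (I.prod 𝓘(ℝ, ℝ)) (productMetric I g ε) (x, t))
        (extChartAt (I.prod 𝓘(ℝ, ℝ)) (x, t) (x, t)) a b c =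
      fderiv ℝ (chartMetric I g x) (extChartAt I x x) a.1 b.1 c.1 := by
    intro a b c
    rw [hpt, hev.fderiv_eq, fderiv_bilin_apply hPd,
      fderiv_bilin_apply (differentiableAt_chartMetric hg x)]
    have hφ : DifferentiableAt ℝ (fun y => chartMetric I g x y b.1 c.1) (extChartAt I x x) :=
      ((differentiableAt_chartMetric hg x).clm_apply (differentiableAt_const _)).clm_apply
        (differentiableAt_const _)
    have h1 : HasFDerivAt (fun z : E × ℝ => chartMetric I g x z.1 b.1 c.1 + ε * (b.2 * c.2))
        ((fderiv ℝ (fun y => chartMetric I g x y b.1 c.1) (extChartAt I x x)).comp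
          (ContinuousLinearMap.fst ℝ E ℝ)) (extChartAt I x x, t) :=
      (HasFDerivAt.comp (g := fun y => chartMetric I g x y b.1 c.1) (extChartAt I x x, t)
        hφ.hasFDerivAt hasFDerivAt_fst).add_const _
    exact DFunLike.congr_fun h1.fderiv a
  rw [christoffelFirst_eq, christoffelFirst_eq, key, key, key]

omit [FiniteDimensional ℝ E] [IsManifold I ∞ M] in
theorem christoffelFirst_smul_right (g : TangentBilinField I M) (x : M) (u v w : E) (c : ℝ) :
    christoffelFirst I g x u v (c • w) = c * christoffelFirst I g x u v w := by
  simp only [christoffelFirst_eq, map_smul, smul_apply, smul_eq_mul]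
  simp
  ring

/-- The Hessian of `w` at `x` for the metric `g`, where `ξ` is the gradient of `w` at `x`. -/
noncomputable def hessianForm (g : TangentBilinField I M) (w : M → ℝ) (x : M) (ξ : E) :
    E →ₗ[ℝ] E →ₗ[ℝ] ℝ :=
  LinearMap.mk₂ ℝ
    (fun v v' => fderiv ℝ (fderiv ℝ (writtenInExtChartAt I 𝓘(ℝ, ℝ) x w)) (extChartAt I x x) v v' -
      christoffelFirst I g x v v' ξ)
    (by intros; simp [christoffelFirst_eq]; ring)
    (by intros; simp [christoffelFirst_eq]; ring)
    (by intros; simp [christoffelFirst_eq]; ring)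
    (by intros; simp [christoffelFirst_eq]; ring)

variable {w : M → ℝ}

omit [FiniteDimensional ℝ E] [IsManifold I ∞ M] [I.Boundaryless] in
theorem mfderiv_graphMap {x : M} (hw : MDifferentiableAt I 𝓘(ℝ, ℝ) w x) (v : E) :
    (mfderiv I (I.prod 𝓘(ℝ, ℝ)) (graphMap w) x v : E × ℝ) =
      (v, (mfderiv I 𝓘(ℝ, ℝ) w x v : ℝ)) := by
  have h := (mdifferentiableAt_id (I := I) (x := x)).hasMFDerivAt.prodMk hw.hasMFDerivAt
  have h2 := h.mfderiv
  refine (congrArg (fun L : E →L[ℝ] (E × ℝ) => L v) h2).trans ?_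
  rw [mfderiv_id]
  rfl

/-- In charts the graph map is `y ↦ (y, ŵ y)`, so `D²F = (0, D²ŵ)` pairs with the normal to give `εs
D²ŵ`. The Christoffel term sees only the component `-εs ξ` of the normal and supplies the correction
of the Hessian. -/
theorem secondFundamentalForm_graphMap {g : TangentBilinField I M}
    (hg : IsSemiRiemannianMetric I g) (ε : ℝ) {x : M} (hw : ContMDiffAt I 𝓘(ℝ, ℝ) 2 w x)
    (ξ : E) (s : ℝ) (v v' : E) :
    secondFundamentalForm I (I.prod 𝓘(ℝ, ℝ)) (productMetric I g ε) (graphMap w) x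
      ((-(ε * s) • ξ, s) : E × ℝ) v v' = ε * s * hessianForm g w x ξ v v' := by
  set ŵ := writtenInExtChartAt I 𝓘(ℝ, ℝ) x w with hŵ
  have hC : ContDiffAt ℝ 2 ŵ (extChartAt I x x) := contDiffAt_writtenInExtChartAt hw
  have hF : writtenInExtChartAt I (I.prod 𝓘(ℝ, ℝ)) x (graphMap w) =ᶠ[𝓝 (extChartAt I x x)]
      fun y => (y, ŵ y) := by
    filter_upwards [extChartAt_target_mem_nhds (I := I) x] with y hy
    simp only [writtenInExtChartAt, extChartAt_prod, graphMap, Function.comp_def]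
    exact Prod.ext ((extChartAt I x).right_inv hy) rfl
  have hF1 : fderiv ℝ (writtenInExtChartAt I (I.prod 𝓘(ℝ, ℝ)) x (graphMap w))
      =ᶠ[𝓝 (extChartAt I x x)] fun y => (ContinuousLinearMap.id ℝ E).prod (fderiv ℝ ŵ y) := by
    filter_upwards [hF.fderiv (𝕜 := ℝ), hC.eventually (by simp)] with y hy hyC
    rw [hy]
    exact ((hasFDerivAt_id y).prodMk (hyC.differentiableAt (by norm_num)).hasFDerivAt).fderiv
  have hF2 : ∀ a b : E, fderiv ℝ (fderiv ℝ (writtenInExtChartAt I (I.prod 𝓘(ℝ, ℝ)) x (graphMap w)))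
      (extChartAt I x x) a b = (0, fderiv ℝ (fderiv ℝ ŵ) (extChartAt I x x) a b) := by
    intro a b
    have hsplit : (fun y => (ContinuousLinearMap.id ℝ E).prod (fderiv ℝ ŵ y)) =
        fun y => ContinuousLinearMap.inl ℝ E ℝ +
          (ContinuousLinearMap.inr ℝ E ℝ).comp (fderiv ℝ ŵ y) := by
      funext y
      ext v <;> simp
    have hd := ((hasFDerivAt_const (ContinuousLinearMap.inr ℝ E ℝ) (extChartAt I x x)).clm_comp
      hC.differentiableAt_fderiv.hasFDerivAt).const_add (ContinuousLinearMap.inl ℝ E ℝ)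
    rw [hF1.fderiv_eq, hsplit, hd.fderiv]
    simp
  have hD := mfderiv_graphMap (I := I) (hw.mdifferentiableAt (by norm_num))
  have e1 : secondFundamentalForm I (I.prod 𝓘(ℝ, ℝ)) (productMetric I g ε) (graphMap w) x
      ((-(ε * s) • ξ, s) : E × ℝ) v v' =
      productMetric I g ε (x, w x)
        (fderiv ℝ (fderiv ℝ (writtenInExtChartAt I (I.prod 𝓘(ℝ, ℝ)) x (graphMap w)))
          (extChartAt I x x) v v' : E × ℝ) ((-(ε * s) • ξ, s) : E × ℝ) +
      christoffelFirst (I.prod 𝓘(ℝ, ℝ)) (productMetric I g ε) (x, w x)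
        (mfderiv I (I.prod 𝓘(ℝ, ℝ)) (graphMap w) x v : E × ℝ)
        (mfderiv I (I.prod 𝓘(ℝ, ℝ)) (graphMap w) x v' : E × ℝ) ((-(ε * s) • ξ, s) : E × ℝ) := by
    simp only [secondFundamentalForm, I.range_eq_univ, fderivWithin_univ]
    rfl
  have e2 : christoffelFirst (I.prod 𝓘(ℝ, ℝ)) (productMetric I g ε) (x, w x)
        (mfderiv I (I.prod 𝓘(ℝ, ℝ)) (graphMap w) x v : E × ℝ)
        (mfderiv I (I.prod 𝓘(ℝ, ℝ)) (graphMap w) x v' : E × ℝ) ((-(ε * s) • ξ, s) : E × ℝ) =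
      -(ε * s) * christoffelFirst I g x v v' ξ :=
    (congrArg₂ (fun a b : E × ℝ => christoffelFirst (I.prod 𝓘(ℝ, ℝ)) (productMetric I g ε) (x, w x)
      a b ((-(ε * s) • ξ, s) : E × ℝ)) (hD v) (hD v')).trans
      ((christoffelFirst_productMetric hg ε x (w x) _ _ _).trans
        (christoffelFirst_smul_right g x v v' ξ _))
  have e3 : productMetric I g ε (x, w x)
        (fderiv ℝ (fderiv ℝ (writtenInExtChartAt I (I.prod 𝓘(ℝ, ℝ)) x (graphMap w)))
          (extChartAt I x x) v v' : E × ℝ) ((-(ε * s) • ξ, s) : E × ℝ) =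
      ε * (fderiv ℝ (fderiv ℝ ŵ) (extChartAt I x x) v v' * s) := by
    refine (productMetric_apply g ε _ _ _).trans ?_
    have h0 : ∀ ζ : E, g x (0 : E) ζ = 0 := fun ζ => by
      have := (g x).map_zero
      exact congrArg (fun L : E →L[ℝ] ℝ => L ζ) this
    rw [hF2]
    refine (congrArg (· + _) (h0 _)).trans (zero_add _)
  rw [e1, e2, e3]
  simp only [hessianForm, LinearMap.mk₂_apply, ← hŵ]
  ring

end GraphGeometry

/-! ### The soliton condition as an equation for the trace of the Hessian. -/

section Characterization

variable {E H : Type*} [NormedAddCommGroup E] [NormedSpace ℝ E] [FiniteDimensional ℝ E]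
  [TopologicalSpace H]
  {I : ModelWithCorners ℝ E H}
  {M : Type*} [TopologicalSpace M] [ChartedSpace H M]

/-- The metric at `x`, as a bilinear form on the model space. -/
noncomputable def metricAt (I : ModelWithCorners ℝ E H) (g : TangentBilinField I M) (x : M) :
    E →L[ℝ] E →L[ℝ] ℝ := g x

/-- The differential of `w` at `x`, as a linear form on the model space. -/
noncomputable def differentialAt (I : ModelWithCorners ℝ E H) (w : M → ℝ) (x : M) : E →L[ℝ] ℝ :=
  mfderiv I 𝓘(ℝ, ℝ) w x

/-- The metric induced on the graph of `w` at `x`. -/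
noncomputable def graphForm (I : ModelWithCorners ℝ E H) (g : TangentBilinField I M) (ε : ℝ) (w : M → ℝ)
    (x : M) : E →ₗ[ℝ] E →ₗ[ℝ] ℝ :=
  LinearMap.mk₂ ℝ
    (fun v v' => metricAt I g x v v' + ε * (differentialAt I w x v * differentialAt I w x v'))
    (by intros; simp; ring) (by intros; simp; ring) (by intros; simp; ring) (by intros; simp; ring)

/-- `ξ` is the gradient of `w` at `x`. -/
noncomputable def IsGradientAt (I : ModelWithCorners ℝ E H) (g : TangentBilinField I M) (w : M → ℝ) (x : M)
    (ξ : E) : Prop :=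
  ∀ v : E, metricAt I g x ξ v = differentialAt I w x v

variable {g : TangentBilinField I M} {ε : ℝ} {w : M → ℝ} {x : M} {ξ : E}

variable [IsManifold I ∞ M]

omit [FiniteDimensional ℝ E] in
theorem metricAt_symm (hg : IsSemiRiemannianMetric I g) (x : M) (v v' : E) :
    metricAt I g x v v' = metricAt I g x v' v := hg.symm x v v'

omit [FiniteDimensional ℝ E] in
theorem metricAt_nondegenerate (hg : IsSemiRiemannianMetric I g) (x : M) (v : E)
    (hv : ∀ v', metricAt I g x v v' = 0) : v = 0 := hg.nondegenerate x v hv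

omit [FiniteDimensional ℝ E] in
/-- If the graph has a nonvanishing normal square `ε + |∇w|²`, its induced metric is
nondegenerate. -/
theorem graphForm_nondegenerate (hg : IsSemiRiemannianMetric I g) (hε : ε = 1 ∨ ε = -1)
    (hξ : IsGradientAt I g w x ξ) (hW : ε + metricAt I g x ξ ξ ≠ 0) (v : E)
    (hv : ∀ v', graphForm I g ε w x v v' = 0) : v = 0 := by
  set G : E →L[ℝ] E →L[ℝ] ℝ := metricAt I g x with hG
  set d : E →L[ℝ] ℝ := differentialAt I w x with hd
  have hsq : ε * ε = 1 := by rcases hε with h | h <;> simp [h]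
  have hsymm : ∀ a b, G a b = G b a := hg.symm x
  have hv' : ∀ v', G v v' + ε * (d v * d v') = 0 := hv
  have h1 : G v ξ = d v := by rw [hsymm]; exact hξ v
  have h2 : d ξ = G ξ ξ := (hξ ξ).symm
  have h3 := hv' ξ
  rw [h1, h2] at h3
  have h4 : d v * (ε + G ξ ξ) = 0 := by linear_combination ε * h3 - d v * G ξ ξ * hsq
  have h5 : d v = 0 := (mul_eq_zero.1 h4).resolve_right hW
  refine metricAt_nondegenerate hg x v fun v' => ?_
  have := hv' v'
  rw [h5] at this
  simpa [hG] using this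

omit [FiniteDimensional ℝ E] [IsManifold I ∞ M] in
theorem inducedMetric_graphMap (hw : MDifferentiableAt I 𝓘(ℝ, ℝ) w x) (v v' : E) :
    inducedMetric I (I.prod 𝓘(ℝ, ℝ)) (productMetric I g ε) (graphMap w) x v v' =
      graphForm I g ε w x v v' := by
  have hD := mfderiv_graphMap (I := I) hw
  exact (congrArg₂ (fun a b : E × ℝ => (productMetric I g ε (x, w x) :
    (E × ℝ) →L[ℝ] (E × ℝ) →L[ℝ] ℝ) a b) (hD v) (hD v')).trans rfl

omit [FiniteDimensional ℝ E] in
-- Orthogonality to every `(v, dw v)` says that `ζ.1` represents the covector `-ε ζ.2 dw`;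
-- nondegeneracy of `g` makes that vector unique.
theorem isNormalTo_graphMap_iff (hg : IsSemiRiemannianMetric I g)
    (hw : MDifferentiableAt I 𝓘(ℝ, ℝ) w x) (hξ : IsGradientAt I g w x ξ) (ζ : E × ℝ) :
    IsNormalTo I (I.prod 𝓘(ℝ, ℝ)) (productMetric I g ε) (graphMap w) x ζ ↔
      ζ = (-(ε * ζ.2) • ξ, ζ.2) := by
  have hD := mfderiv_graphMap (I := I) hw
  set G : E →L[ℝ] E →L[ℝ] ℝ := metricAt I g x with hG
  set d : E →L[ℝ] ℝ := differentialAt I w x with hd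
  have hsymm : ∀ a b, G a b = G b a := hg.symm x
  have hval : ∀ v : E, productMetric I g ε (graphMap w x)
      (mfderiv I (I.prod 𝓘(ℝ, ℝ)) (graphMap w) x v) ζ = G v ζ.1 + ε * (d v * ζ.2) := fun v =>
    (congrArg (fun a : E × ℝ => (productMetric I g ε (x, w x) :
      (E × ℝ) →L[ℝ] (E × ℝ) →L[ℝ] ℝ) a ζ) (hD v)).trans rfl
  have hξ' : ∀ v, G v ξ = d v := fun v => by rw [hsymm]; exact hξ v
  constructor
  · intro h
    refine Prod.ext ?_ rfl
    change ζ.1 = -(ε * ζ.2) • ξ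
    rw [← sub_eq_zero]
    refine metricAt_nondegenerate hg x _ fun v => ?_
    change G (ζ.1 - -(ε * ζ.2) • ξ) v = 0
    rw [hsymm, map_sub, map_smul, hξ', smul_eq_mul]
    linear_combination (hval v).symm.trans (h v)
  · intro h (v : E)
    refine (hval v).trans ?_
    have h1 : G v ζ.1 = -(ε * ζ.2) * d v := by
      rw [congrArg Prod.fst h, map_smul, hξ', smul_eq_mul]
    rw [h1]
    ring

theorem exists_isGradientAt (hg : IsSemiRiemannianMetric I g) (w : M → ℝ) (x : M) :
    ∃ ξ, IsGradientAt I g w x ξ := by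
  set G : E →L[ℝ] E →L[ℝ] ℝ := metricAt I g x with hG
  set Gl : E →ₗ[ℝ] Module.Dual ℝ E :=
    LinearMap.mk₂ ℝ (fun v w => G v w) (by simp) (by simp) (by simp) (by simp)
  have hinj : Function.Injective Gl := by
    rw [injective_iff_map_eq_zero]
    intro v hv
    exact hg.nondegenerate x v fun w => DFunLike.congr_fun hv w
  obtain ⟨ξ, hξ⟩ := (LinearMap.injective_iff_surjective_of_finrank_eq_finrank
    Subspace.dual_finrank_eq.symm).1 hinj
      (differentialAt I w x : Module.Dual ℝ E)
  exact ⟨ξ, fun v => DFunLike.congr_fun hξ v⟩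

omit [FiniteDimensional ℝ E] [IsManifold I ∞ M] in
theorem productMetric_normal (p : M × ℝ) (hε : ε = 1 ∨ ε = -1) (s s' : ℝ) :
    productMetric I g ε p ((-(ε * s) • ξ, s) : E × ℝ) ((-(ε * s') • ξ, s') : E × ℝ) =
      s * s' * (ε + metricAt I g p.1 ξ ξ) := by
  refine (productMetric_apply g ε p _ _).trans ?_
  change metricAt I g p.1 (-(ε * s) • ξ) (-(ε * s') • ξ) + ε * (s * s') = _
  have hsq : ε * ε = 1 := by rcases hε with h | h <;> simp [h]
  simp only [map_smul, smul_apply, smul_eq_mul]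
  linear_combination s * s' * metricAt I g p.1 ξ ξ * hsq

theorem metricTrace_secondFundamentalForm_graphMap [I.Boundaryless]
    (hg : IsSemiRiemannianMetric I g) (hw : ContMDiffAt I 𝓘(ℝ, ℝ) 2 w x) (s : ℝ) :
    metricTrace (V := E)
      (inducedMetric I (I.prod 𝓘(ℝ, ℝ)) (productMetric I g ε) (graphMap w) x)
      (secondFundamentalForm I (I.prod 𝓘(ℝ, ℝ)) (productMetric I g ε) (graphMap w) x
        ((-(ε * s) • ξ, s) : E × ℝ)) =
      ε * s * metricTrace (fun v v' : E => graphForm I g ε w x v v')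
        (fun v v' => hessianForm g w x ξ v v') := by
  rw [← metricTrace_smul]
  congr 1
  · funext v v'
    exact inducedMetric_graphMap (hw.mdifferentiableAt (by norm_num)) v v'
  · funext v v'
    exact secondFundamentalForm_graphMap hg ε hw ξ s v v'

/-- The graph of `w` is a graphical translating soliton iff its normals have constant sign and
`tr_γ Hess w = 1`, where `γ = g + ε dw ⊗ dw` is the induced metric. -/
theorem isGraphicalTranslatingSoliton_iff [I.Boundaryless]
    (hg : IsSemiRiemannianMetric I g) (hε : ε = 1 ∨ ε = -1) (hw : ContMDiff I 𝓘(ℝ, ℝ) 2 w)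
    (ξ : M → E) (hξ : ∀ x, IsGradientAt I g w x (ξ x)) :
    IsGraphicalTranslatingSoliton I g ε w ↔
      (∃ ε' : ℝ, (ε' = 1 ∨ ε' = -1) ∧ ∀ x, 0 < ε' * (ε + metricAt I g x (ξ x) (ξ x))) ∧
      ∀ x, metricTrace (fun v v' : E => graphForm I g ε w x v v')
        (fun v v' => hessianForm g w x (ξ x) v v') = 1 := by
  have hsq : ε * ε = 1 := by rcases hε with h | h <;> simp [h]
  have hε0 : ε ≠ 0 := by rintro rfl; simp at hsq
  have hd : ∀ x, MDifferentiableAt I 𝓘(ℝ, ℝ) w x := fun x =>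
    (hw x).mdifferentiableAt (by norm_num)
  have hnormal : ∀ x s, IsNormalTo I (I.prod 𝓘(ℝ, ℝ)) (productMetric I g ε) (graphMap w) x
      ((-(ε * s) • ξ x, s) : E × ℝ) := fun x s =>
    (isNormalTo_graphMap_iff hg (hd x) (hξ x) _).2 rfl
  have hT : ∀ (x : M) (ζ : E × ℝ), productMetric I g ε (graphMap w x) (partialT I (graphMap w x)) ζ
      = ε * ζ.2 := by
    intro x ζ
    refine (productMetric_apply g ε (graphMap w x) ((0, 1) : E × ℝ) ζ).trans ?_
    change metricAt I g x 0 ζ.1 + ε * (1 * ζ.2) = _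
    simp
  constructor
  · rintro ⟨⟨ε', h⟩, -, h'⟩
    refine ⟨⟨ε', h.sign_eq, fun x => ?_⟩, fun x => ?_⟩
    · have h1 := h.normal_sign x _ (hnormal x 1) (fun h0 => one_ne_zero (congrArg Prod.snd h0))
      have h2 := productMetric_normal (I := I) (g := g) (ξ := ξ x) (graphMap w x) hε 1 1
      have h3 := h1.trans_eq (congrArg (ε' * ·) h2)
      simpa [graphMap] using h3
    · obtain ⟨η, ⟨hη, hmc⟩, hη', v, hv⟩ := h' x
      have h1 := hmc _ (hnormal x 1)
      have h1' := h1.trans (metricTrace_secondFundamentalForm_graphMap hg (hw x) 1)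
      have h2 := hT x ((-(ε * 1) • ξ x, 1) : E × ℝ)
      -- The tangential part of `∂_t` pairs to zero with the normal, so `∂_t` and `η` have the same
      -- product with it.
      have h3 : productMetric I g ε (graphMap w x) (partialT I (graphMap w x))
          ((-(ε * 1) • ξ x, 1) : E × ℝ) = productMetric I g ε (graphMap w x) η
          ((-(ε * 1) • ξ x, 1) : E × ℝ) := by
        have h4 := hnormal x 1 v
        rw [hv, map_add]
        exact (congrArg (· + _) h4).trans (zero_add _)
      have h5 := h3.symm.trans h2
      have h6 := h1'.symm.trans h5
      have h7 : ε * (metricTrace (fun v v' : E => graphForm I g ε w x v v')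
        (fun v v' => hessianForm g w x (ξ x) v v') - 1) = 0 := by linear_combination h6
      rcases mul_eq_zero.1 h7 with h8 | h8
      · exact absurd h8 hε0
      · linarith
  · rintro ⟨⟨ε', hε', hW⟩, htr⟩
    have hW0 : ∀ x, ε + metricAt I g x (ξ x) (ξ x) ≠ 0 := fun x h0 => by
      have := hW x; rw [h0] at this; simp at this
    have himm : IsSemiRiemannianImmersion I (I.prod 𝓘(ℝ, ℝ)) (productMetric I g ε)
        (graphMap w) := by
      refine ⟨contMDiff_id.prodMk hw, fun x v v' h => ?_, fun x v h => ?_⟩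
      · exact congrArg Prod.fst ((mfderiv_graphMap (hd x) v).symm.trans
          (Eq.trans h (mfderiv_graphMap (hd x) v')))
      · exact graphForm_nondegenerate hg hε (hξ x) (hW0 x) v fun v' =>
          (inducedMetric_graphMap (hd x) v v').symm.trans (h v')
    refine ⟨⟨ε', himm, ?_, hε', fun x ν hν hν0 => ?_⟩, himm, fun x => ?_⟩
    · simp
    · have h1 := (isNormalTo_graphMap_iff hg (hd x) (hξ x) ν).1 hν
      obtain ⟨s, rfl⟩ : ∃ s : ℝ, ν = ((-(ε * s) • ξ x, s) : E × ℝ) := ⟨_, h1⟩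
      have hs : s ≠ 0 := by
        rintro rfl
        have hz : (-(ε * 0)) • ξ x = 0 := by simp
        exact hν0 (congrArg₂ Prod.mk hz rfl)
      have h2 := productMetric_normal (I := I) (g := g) (ξ := ξ x) (graphMap w x) hε s s
      refine lt_of_lt_of_eq ?_ (congrArg (ε' * ·) h2).symm
      have h3 := mul_pos (mul_self_pos.2 hs) (hW x)
      change 0 < ε' * (s * s * (ε + metricAt I g x (ξ x) (ξ x)))
      linarith
    · set W := ε + metricAt I g x (ξ x) (ξ x) with hWdef
      have hWx : W ≠ 0 := hW0 x
      -- With `ν = (-ε ξ, 1)`, the normal part of `∂_t` is `(⟨∂_t, ν⟩ / ⟨ν, ν⟩) ν = (ε / W) ν`. What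
      -- remains has first component `ξ / W`, as `ε² = 1`, and is the tangent vector over it.
      refine ⟨((-(ε * (ε / W)) • ξ x, ε / W) : E × ℝ), ⟨hnormal x _, fun ζ hζ => ?_⟩, hnormal x _,
        (1 / W) • ξ x, ?_⟩
      · have h1 := (isNormalTo_graphMap_iff hg (hd x) (hξ x) ζ).1 hζ
        obtain ⟨s, rfl⟩ : ∃ s : ℝ, ζ = ((-(ε * s) • ξ x, s) : E × ℝ) := ⟨_, h1⟩
        have h2 := productMetric_normal (I := I) (g := g) (ξ := ξ x) (graphMap w x) hε (ε / W) s
        have h3 := metricTrace_secondFundamentalForm_graphMap (ε := ε) (ξ := ξ x) hg (hw x) s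
        refine h2.trans (Eq.trans ?_ h3.symm)
        rw [htr x]
        change ε / W * s * W = _
        field_simp
      · have h1 := mfderiv_graphMap (hd x) ((1 / W) • ξ x)
        have h2 : differentialAt I w x ((1 / W) • ξ x) = (1 / W) * (W - ε) := by
          rw [map_smul, ← hξ x, hWdef, smul_eq_mul]; ring
        have h3 : ((0, 1) : E × ℝ) = ((1 / W) • ξ x, differentialAt I w x ((1 / W) • ξ x)) +
            (-(ε * (ε / W)) • ξ x, ε / W) := by
          rw [h2]
          refine Prod.ext ?_ ?_
          · simp only [Prod.fst_add]
            rw [← add_smul]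
            have : 1 / W + -(ε * (ε / W)) = 0 := by
              rw [← mul_div_assoc, hsq]; ring
            rw [this, zero_smul]
          · simp only [Prod.snd_add]
            field_simp
            ring
        exact h3.trans (congrArg (· + ((-(ε * (ε / W)) • ξ x, ε / W) : E × ℝ)) h1.symm)

end Characterization

/-! ### Horizontal lifts and the isometry property in charts. -/

section SubmersionGeometry

open Topology Filter

variable {EM HM : Type*} [NormedAddCommGroup EM] [NormedSpace ℝ EM] [FiniteDimensional ℝ EM]
  [TopologicalSpace HM] {IM : ModelWithCorners ℝ EM HM}
  {M : Type*} [TopologicalSpace M] [ChartedSpace HM M]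
  {EB HB : Type*} [NormedAddCommGroup EB] [NormedSpace ℝ EB] [FiniteDimensional ℝ EB]
  [TopologicalSpace HB] {IB : ModelWithCorners ℝ EB HB}
  {B : Type*} [TopologicalSpace B] [ChartedSpace HB B]

/-- The differential of `f` at `x`, as a linear map between the model spaces. -/
noncomputable def tangentMapAt (IM : ModelWithCorners ℝ EM HM) (IB : ModelWithCorners ℝ EB HB) (f : M → B)
    (x : M) : EM →L[ℝ] EB := mfderiv IM IB f x

variable [IsManifold IM ∞ M] [IsManifold IB ∞ B]
  {gM : TangentBilinField IM M} {gB : TangentBilinField IB B} {π : M → B}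

omit [FiniteDimensional ℝ EB] [IsManifold IB ∞ B] in
-- Only one of the two vectors has to be horizontal: removing the vertical part of `w` changes
-- neither side.
theorem IsSemiRiemannianSubmersion.metricAt_horizontal
    (hgM : IsSemiRiemannianMetric IM gM) (hπ : IsSemiRiemannianSubmersion IM IB gM gB π) {x : M}
    {v : EM} (hv : ∀ z, tangentMapAt IM IB π x z = 0 → metricAt IM gM x v z = 0) (w : EM) :
    metricAt IB gB (π x) (tangentMapAt IM IB π x v) (tangentMapAt IM IB π x w) =
      metricAt IM gM x v w := by
  set G := metricAt IM gM x
  set P := tangentMapAt IM IB π x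
  obtain ⟨z, hz, hwz⟩ := exists_mem_ker_sub_orthogonal
    (LinearMap.mk₂ ℝ (fun v w => G v w) (by simp) (by simp) (by simp) (by simp))
    (metricAt_symm hgM x) (P : EM →ₗ[ℝ] EB) (hπ.fiber_nondegenerate x) w
  have h1 : metricAt IB gB (π x) (P v) (P (w - z)) = G v (w - z) :=
    hπ.isometry_horizontal x v (w - z) hv hwz
  have hz' : P z = 0 := hz
  rw [map_sub P, hz', sub_zero, map_sub, hv z hz', sub_zero] at h1
  exact h1

omit [FiniteDimensional ℝ EB] in
/-- The horizontal lift. -/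
theorem IsSemiRiemannianSubmersion.exists_horizontalLift
    (hgM : IsSemiRiemannianMetric IM gM) (hgB : IsSemiRiemannianMetric IB gB)
    (hπ : IsSemiRiemannianSubmersion IM IB gM gB π) (x : M) :
    ∃ j : EB →ₗ[ℝ] EM, (∀ b, tangentMapAt IM IB π x (j b) = b) ∧
      ∀ b v, metricAt IM gM x (j b) v = metricAt IB gB (π x) b (tangentMapAt IM IB π x v) := by
  set G := metricAt IM gM x with hG
  set P := tangentMapAt IM IB π x with hP
  set Q := metricAt IB gB (π x) with hQ
  set Gl : EM →ₗ[ℝ] Module.Dual ℝ EM :=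
    LinearMap.mk₂ ℝ (fun v w => G v w) (by simp) (by simp) (by simp) (by simp) with hGl
  have hinj : Function.Injective Gl := by
    rw [injective_iff_map_eq_zero]
    intro v hv
    exact metricAt_nondegenerate hgM x v fun w => DFunLike.congr_fun hv w
  set e := LinearEquiv.ofInjectiveOfFinrankEq Gl hinj Subspace.dual_finrank_eq.symm
  -- The lift of `b` is the `gM`-dual of the covector `v ↦ gB (b, dπ v)`. This covector kills
  -- vertical vectors, so the lift is horizontal, and the isometry property then forces `dπ` to send
  -- it back to `b`.
  set L : EB →ₗ[ℝ] Module.Dual ℝ EM :=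
    LinearMap.mk₂ ℝ (fun b v => Q b (P v)) (by simp) (by simp) (by simp) (by simp) with hL
  have hj : ∀ b v, G (e.symm (L b)) v = Q b (P v) := fun b v =>
    DFunLike.congr_fun (e.apply_symm_apply (L b)) v
  refine ⟨e.symm.toLinearMap ∘ₗ L, fun b => ?_, hj⟩
  change P (e.symm (L b)) = b
  rw [← sub_eq_zero]
  refine metricAt_nondegenerate hgB (π x) _ fun c => ?_
  obtain ⟨v, rfl⟩ : ∃ v, P v = c := hπ.surjective_mfderiv x c
  have h1 : Q (P (e.symm (L b))) (P v) = G (e.symm (L b)) v :=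
    hπ.metricAt_horizontal hgM (fun z hz => by
      change G _ z = 0
      rw [hj]
      change Q b (tangentMapAt IM IB π x z) = 0
      rw [hz, map_zero]) v
  change Q (P (e.symm (L b)) - b) (P v) = 0
  rw [map_sub, sub_apply, h1, hj, sub_self]

variable [IM.Boundaryless] [IB.Boundaryless]

omit [FiniteDimensional ℝ EM] [IsManifold IM ∞ M] in
theorem chartMetric_apply (g : TangentBilinField IM M) (x : M) (y : EM) (v w : EM) :
    chartMetric IM g x y v w = metricAt IM g ((extChartAt IM x).symm y)
      (mfderiv 𝓘(ℝ, EM) IM (extChartAt IM x).symm y v)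
      (mfderiv 𝓘(ℝ, EM) IM (extChartAt IM x).symm y w) := by
  have h : mfderivWithin 𝓘(ℝ, EM) IM (extChartAt IM x).symm (range IM) y =
      mfderiv 𝓘(ℝ, EM) IM (extChartAt IM x).symm y := by
    rw [IM.range_eq_univ, mfderivWithin_univ]
  rw [← h]
  rfl

omit [FiniteDimensional ℝ EB] in
-- With `A` and `C` the differentials of the inverse charts, the chain rule reads `C ∘ Dp = dπ ∘ A`.
-- As `A` is surjective and `C` injective, the kernels of `Dp` and `dπ` correspond, and with them
-- the horizontal vectors.
theorem IsSemiRiemannianSubmersion.eventually_chartMetric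
    (hgM : IsSemiRiemannianMetric IM gM) (hπ : IsSemiRiemannianSubmersion IM IB gM gB π) (x : M) :
    ∀ᶠ y in 𝓝 (extChartAt IM x x), ∀ v,
      (∀ z, fderiv ℝ (writtenInExtChartAt IM IB x π) y z = 0 → chartMetric IM gM x y v z = 0) →
      ∀ w, chartMetric IB gB (π x) (writtenInExtChartAt IM IB x π y)
        (fderiv ℝ (writtenInExtChartAt IM IB x π) y v)
        (fderiv ℝ (writtenInExtChartAt IM IB x π) y w) = chartMetric IM gM x y v w := by
  have : IsManifold IM 1 M := IsManifold.of_le (n := ∞) (by simp)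
  have : IsManifold IB 1 B := IsManifold.of_le (n := ∞) (by simp)
  have hp : ContDiffAt ℝ 1 (writtenInExtChartAt IM IB x π) (extChartAt IM x x) :=
    contDiffAt_writtenInExtChartAt ((hπ.smooth x).of_le (by simp))
  have hsrc : ∀ᶠ y in 𝓝 (extChartAt IM x x),
      π ((extChartAt IM x).symm y) ∈ (extChartAt IB (π x)).source := by
    have hc : ContinuousAt (fun y => π ((extChartAt IM x).symm y)) (extChartAt IM x x) := by
      refine ContinuousAt.comp (g := π) hπ.smooth.continuous.continuousAt
        (continuousAt_extChartAt_symm x)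
    refine hc.eventually ?_
    change _ ∈ 𝓝 (π ((extChartAt IM x).symm (extChartAt IM x x)))
    rw [extChartAt_to_inv]
    exact extChartAt_source_mem_nhds (π x)
  filter_upwards [hsrc.eventually_nhds, extChartAt_target_mem_nhds (I := IM) x,
    hp.eventually (by simp)] with y hy hyt hyp v hv w
  set p := writtenInExtChartAt IM IB x π with hpdef
  have hq : (extChartAt IB (π x)).symm (p y) = π ((extChartAt IM x).symm y) :=
    (extChartAt IB (π x)).left_inv hy.self_of_nhds
  have hpt : p y ∈ (extChartAt IB (π x)).target :=
    (extChartAt IB (π x)).map_source hy.self_of_nhds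
  have hA : MDifferentiableAt 𝓘(ℝ, EM) IM (extChartAt IM x).symm y := by
    have := mdifferentiableWithinAt_extChartAt_symm (I := IM) hyt
    rwa [IM.range_eq_univ, mdifferentiableWithinAt_univ] at this
  have hC : MDifferentiableAt 𝓘(ℝ, EB) IB (extChartAt IB (π x)).symm (p y) := by
    have := mdifferentiableWithinAt_extChartAt_symm (I := IB) hpt
    rwa [IB.range_eq_univ, mdifferentiableWithinAt_univ] at this
  have hAinv : (mfderiv 𝓘(ℝ, EM) IM (extChartAt IM x).symm y).IsInvertible := by
    have := isInvertible_mfderivWithin_extChartAt_symm (I := IM) hyt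
    rwa [IM.range_eq_univ, mfderivWithin_univ] at this
  have hCinv : (mfderiv 𝓘(ℝ, EB) IB (extChartAt IB (π x)).symm (p y)).IsInvertible := by
    have := isInvertible_mfderivWithin_extChartAt_symm (I := IB) hpt
    rwa [IB.range_eq_univ, mfderivWithin_univ] at this
  set A : EM →L[ℝ] EM := mfderiv 𝓘(ℝ, EM) IM (extChartAt IM x).symm y with hAdef
  set C : EB →L[ℝ] EB := mfderiv 𝓘(ℝ, EB) IB (extChartAt IB (π x)).symm (p y) with hCdef
  set q := (extChartAt IM x).symm y with hqdef
  have hπq : MDifferentiableAt IM IB π q := (hπ.smooth q).mdifferentiableAt (by simp)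
  have hchain : ∀ v : EM, C (fderiv ℝ p y v) = tangentMapAt IM IB π q (A v) := by
    have h1 := hπq.hasMFDerivAt.comp y hA.hasMFDerivAt
    have h2 := hC.hasMFDerivAt.comp y
      (hyp.differentiableAt (by norm_num)).hasFDerivAt.hasMFDerivAt
    have h3 : (extChartAt IB (π x)).symm ∘ p =ᶠ[𝓝 y] π ∘ (extChartAt IM x).symm := by
      filter_upwards [hy] with z hz
      exact (extChartAt IB (π x)).left_inv hz
    have h4 := hasMFDerivAt_unique (h2.congr_of_eventuallyEq h3.symm) h1
    exact fun v => DFunLike.congr_fun h4 v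
  have hAs : Function.Surjective A := fun v => by
    obtain ⟨e, he⟩ := hAinv
    exact ⟨e.symm v, (DFunLike.congr_fun he (e.symm v)).symm.trans (e.apply_symm_apply v)⟩
  have hCi : ∀ v, C v = 0 → v = 0 := fun v hv => by
    obtain ⟨e, he⟩ := hCinv
    exact e.map_eq_zero_iff.1 ((DFunLike.congr_fun he v).trans hv)
  rw [chartMetric_apply, chartMetric_apply, hq]
  change metricAt IB gB (π q) (C (fderiv ℝ p y v)) (C (fderiv ℝ p y w)) =
    metricAt IM gM q (A v) (A w)
  rw [hchain, hchain]
  refine hπ.metricAt_horizontal hgM (fun z hz => ?_) _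
  obtain ⟨z, rfl⟩ := hAs z
  rw [← hchain] at hz
  exact (chartMetric_apply gM x y v z).symm.trans (hv z (hCi _ hz))

end SubmersionGeometry

/-! ### The Hessian of a function along fibers and on horizontal vectors. -/

section HessianComparison

open Topology Filter

variable {EM HM : Type*} [NormedAddCommGroup EM] [NormedSpace ℝ EM] [FiniteDimensional ℝ EM]
  [TopologicalSpace HM] {IM : ModelWithCorners ℝ EM HM} [IM.Boundaryless]
  {M : Type*} [TopologicalSpace M] [ChartedSpace HM M] [IsManifold IM ∞ M]
  {gM : TangentBilinField IM M}

section Vertical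

variable {k : ℕ} {f : EuclideanSpace ℝ (Fin k) → M} {w : M → ℝ}

omit [FiniteDimensional ℝ EM] in
/-- On vectors tangent to a submanifold on which `w` is constant, the Hessian of `w` is minus the
second fundamental form in the direction of the gradient. -/
theorem hessianForm_tangent_of_const (hf : ContMDiffAt (𝓡 k) IM 2 f 0)
    (hw : ContMDiffAt IM 𝓘(ℝ, ℝ) 2 w (f 0)) (hconst : ∀ᶠ y in 𝓝 0, w (f y) = w (f 0))
    {ξ : EM} (hξ : IsGradientAt IM gM w (f 0) ξ) (hgM : IsSemiRiemannianMetric IM gM)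
    (a b : EuclideanSpace ℝ (Fin k)) :
    hessianForm gM w (f 0) ξ (tangentMapAt (𝓡 k) IM f 0 a) (tangentMapAt (𝓡 k) IM f 0 b) =
      (-1) * secondFundamentalForm (𝓡 k) IM gM f 0 ξ a b := by
  set ŵ := writtenInExtChartAt IM 𝓘(ℝ, ℝ) (f 0) w with hŵ
  set p := writtenInExtChartAt (𝓡 k) IM 0 f with hp
  have hwC : ContDiffAt ℝ 2 ŵ (extChartAt IM (f 0) (f 0)) := contDiffAt_writtenInExtChartAt hw
  have hpC : ContDiffAt ℝ 2 p 0 := contDiffAt_writtenInExtChartAt hf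
  have hp0 : p 0 = extChartAt IM (f 0) (f 0) := rfl
  have hev : ŵ ∘ p =ᶠ[𝓝 0] fun _ => w (f 0) := by
    have hsrc : ∀ᶠ y in 𝓝 0, f y ∈ (extChartAt IM (f 0)).source :=
      hf.continuousAt.eventually (extChartAt_source_mem_nhds (f 0))
    filter_upwards [hconst, hsrc] with y hy hys
    rw [← hy]
    exact congrArg w ((extChartAt IM (f 0)).left_inv hys)
  -- Since `w ∘ f` is constant near `0`, this chain rule becomes `D²w (df a, df b) + dw (D²f (a, b))
  -- = 0`, and `dw` is the product with `ξ`.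
  have hD2 := fderiv_fderiv_comp_apply (hp0 ▸ hwC) hpC a b
  have hz : fderiv ℝ (fderiv ℝ (ŵ ∘ p)) 0 a b = 0 := by
    have h1 : fderiv ℝ (ŵ ∘ p) =ᶠ[𝓝 0] fun _ => 0 := by
      refine (hev.fderiv (𝕜 := ℝ)).trans (Eventually.of_forall fun y => ?_)
      simp
    rw [h1.fderiv_eq]
    simp
  rw [hz, hp0] at hD2
  have hda : ∀ a, tangentMapAt (𝓡 k) IM f 0 a = fderiv ℝ p 0 a :=
    mfderiv_eq_fderiv_writtenInExtChartAt (hf.mdifferentiableAt (by norm_num))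
  have hdw : ∀ v, fderiv ℝ ŵ (extChartAt IM (f 0) (f 0)) v = metricAt IM gM (f 0) ξ v := fun v =>
    (mfderiv_eq_fderiv_writtenInExtChartAt (hw.mdifferentiableAt (by norm_num)) v).symm.trans
      (hξ v).symm
  have hS : secondFundamentalForm (𝓡 k) IM gM f 0 ξ a b =
      metricAt IM gM (f 0) (fderiv ℝ (fderiv ℝ p) 0 a b) ξ +
        christoffelFirst IM gM (f 0) (tangentMapAt (𝓡 k) IM f 0 a)
          (tangentMapAt (𝓡 k) IM f 0 b) ξ := by
    have h1 : fderivWithin ℝ (fderivWithin ℝ p (range (𝓡 k))) (range (𝓡 k)) 0 =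
        fderiv ℝ (fderiv ℝ p) 0 := by
      rw [(𝓡 k).range_eq_univ]
      simp only [fderivWithin_univ]
    rw [← h1]
    rfl
  rw [hS, hessianForm, LinearMap.mk₂_apply, metricAt_symm hgM, ← hdw, ← hŵ]
  rw [hda, hda]
  linear_combination -hD2

end Vertical

variable {EB HB : Type*} [NormedAddCommGroup EB] [NormedSpace ℝ EB] [FiniteDimensional ℝ EB]
  [TopologicalSpace HB] {IB : ModelWithCorners ℝ EB HB} [IB.Boundaryless]
  {B : Type*} [TopologicalSpace B] [ChartedSpace HB B] [IsManifold IB ∞ B]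
  {gB : TangentBilinField IB B} {π : M → B} {u : B → ℝ}

omit [FiniteDimensional ℝ EM] [IM.Boundaryless] [IsManifold IM ∞ M] [FiniteDimensional ℝ EB]
  [IB.Boundaryless] [IsManifold IB ∞ B] in
theorem differentialAt_comp (hπ : IsSemiRiemannianSubmersion IM IB gM gB π)
    (hu : ContMDiff IB 𝓘(ℝ, ℝ) 2 u) (x : M) (v : EM) :
    differentialAt IM (u ∘ π) x v = differentialAt IB u (π x) (tangentMapAt IM IB π x v) := by
  have h := mfderiv_comp x ((hu (π x)).mdifferentiableAt (by norm_num))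
    ((hπ.smooth x).mdifferentiableAt (by simp))
  exact DFunLike.congr_fun h v

/-- On horizontal vectors, the Hessian of `u ∘ π` is the Hessian of `u`. -/
theorem hessianForm_horizontal (hgM : IsSemiRiemannianMetric IM gM)
    (hgB : IsSemiRiemannianMetric IB gB) (hπ : IsSemiRiemannianSubmersion IM IB gM gB π)
    (hu : ContMDiff IB 𝓘(ℝ, ℝ) 2 u) {x : M} {ξ : EB} (hξ : IsGradientAt IB gB u (π x) ξ)
    {j : EB →ₗ[ℝ] EM} (hj : ∀ b, tangentMapAt IM IB π x (j b) = b)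
    (hj' : ∀ b v, metricAt IM gM x (j b) v = metricAt IB gB (π x) b (tangentMapAt IM IB π x v))
    (b c : EB) :
    hessianForm gM (u ∘ π) x (j ξ) (j b) (j c) = hessianForm gB u (π x) ξ b c := by
  have : IsManifold IM 1 M := IsManifold.of_le (n := ∞) (by simp)
  have : IsManifold IB 1 B := IsManifold.of_le (n := ∞) (by simp)
  set û := writtenInExtChartAt IB 𝓘(ℝ, ℝ) (π x) u with hû
  set p := writtenInExtChartAt IM IB x π with hp
  set x₀ := extChartAt IM x x with hx₀
  have hp0 : p x₀ = extChartAt IB (π x) (π x) := by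
    simp only [hp, hx₀, writtenInExtChartAt, Function.comp_apply, extChartAt_to_inv]
  have huC : ContDiffAt ℝ 2 û (p x₀) := by
    rw [hp0]; exact contDiffAt_writtenInExtChartAt (hu (π x))
  have hπ2 : ContMDiffAt IM IB 2 π x := (hπ.smooth x).of_le (by norm_cast)
  have hpC : ContDiffAt ℝ 2 p x₀ := contDiffAt_writtenInExtChartAt hπ2
  have hdp : ∀ v, fderiv ℝ p x₀ v = tangentMapAt IM IB π x v := fun v =>
    (mfderiv_eq_fderiv_writtenInExtChartAt (hπ2.mdifferentiableAt (by norm_num)) v).symm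
  have hdu : ∀ v, fderiv ℝ û (p x₀) v = metricAt IB gB (π x) ξ v := fun v => by
    rw [hp0]
    exact (mfderiv_eq_fderiv_writtenInExtChartAt
      ((hu (π x)).mdifferentiableAt (by norm_num)) v).symm.trans (hξ v).symm
  have hcomp : writtenInExtChartAt IM 𝓘(ℝ, ℝ) x (u ∘ π) =ᶠ[𝓝 x₀] û ∘ p := by
    have hc : ContinuousAt (fun y => π ((extChartAt IM x).symm y)) x₀ :=
      ContinuousAt.comp (g := π) hπ.smooth.continuous.continuousAt
        (continuousAt_extChartAt_symm x)
    have hsrc : ∀ᶠ y in 𝓝 x₀, π ((extChartAt IM x).symm y) ∈ (extChartAt IB (π x)).source := by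
      refine hc.eventually ?_
      change _ ∈ 𝓝 (π ((extChartAt IM x).symm (extChartAt IM x x)))
      rw [extChartAt_to_inv]
      exact extChartAt_source_mem_nhds (π x)
    filter_upwards [hsrc] with y hy
    exact (congrArg u ((extChartAt IB (π x)).left_inv hy)).symm
  have hG : ∀ v v', chartMetric IM gM x x₀ v v' = metricAt IM gM x v v' := chartMetric_self gM x
  have hQ : ∀ v v', chartMetric IB gB (π x) (p x₀) v v' = metricAt IB gB (π x) v v' := by
    rw [hp0]; exact chartMetric_self gB (π x)
  have hhor : ∀ b, ∀ z, fderiv ℝ p x₀ z = 0 → chartMetric IM gM x x₀ (j b) z = 0 := by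
    intro b z hz
    rw [hG, hj', ← hdp, hz, map_zero]
  have hΓ := (christoffelFirst_eq gM x (j b) (j c) (j ξ)).trans
    (christoffel_horizontal (x := x₀) (p := p) (differentiableAt_chartMetric hgM x)
    (by rw [hp0]; exact differentiableAt_chartMetric hgB (π x)) hpC
    (fun v w => by rw [hG, hG, metricAt_symm hgM]) (fun v w => by rw [hQ, hQ, metricAt_symm hgB])
    (fun v hv => metricAt_nondegenerate hgM x v fun w => by rw [← hG, hv])
    (hπ.eventually_chartMetric hgM x) (hhor b) (hhor c) (hhor ξ))
  simp only [hdp, hj, hQ] at hΓ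
  rw [hp0, ← christoffelFirst_eq] at hΓ
  -- The second derivative of `û ∘ p` contains `dû (D²p (j b, j c))`, which equals the product of
  -- `D²p (j b, j c)` with `ξ`, the very term that `hΓ` adds to the Christoffel symbol. The two
  -- cancel in the Hessian.
  have hD2 := fderiv_fderiv_comp_apply huC hpC (j b) (j c)
  rw [hdp, hdp, hj, hj, hdu, hp0] at hD2
  have hw2 : fderiv ℝ (fderiv ℝ (writtenInExtChartAt IM 𝓘(ℝ, ℝ) x (u ∘ π))) x₀ (j b) (j c) =
      fderiv ℝ (fderiv ℝ (û ∘ p)) x₀ (j b) (j c) := by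
    rw [(hcomp.fderiv (𝕜 := ℝ)).fderiv_eq]
  simp only [hessianForm, LinearMap.mk₂_apply]
  rw [hw2, hD2, hΓ, metricAt_symm hgB]
  ring

end HessianComparison

/-! ### Invariance of the trace, and the theorem. -/

section Lifting

open Topology Filter

variable {EM HM : Type*} [NormedAddCommGroup EM] [NormedSpace ℝ EM] [FiniteDimensional ℝ EM]
  [TopologicalSpace HM] {IM : ModelWithCorners ℝ EM HM} [IM.Boundaryless]
  {M : Type*} [TopologicalSpace M] [ChartedSpace HM M] [IsManifold IM ∞ M]
  {gM : TangentBilinField IM M}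
  {EB HB : Type*} [NormedAddCommGroup EB] [NormedSpace ℝ EB] [FiniteDimensional ℝ EB]
  [TopologicalSpace HB] {IB : ModelWithCorners ℝ EB HB} [IB.Boundaryless]
  {B : Type*} [TopologicalSpace B] [ChartedSpace HB B] [IsManifold IB ∞ B]
  {gB : TangentBilinField IB B} {π : M → B} {u : B → ℝ} {ε : ℝ}

/-- The trace of the Hessian of `u ∘ π` in the metric induced on its graph is that of `u`. -/
theorem metricTrace_hessianForm_comp (hgM : IsSemiRiemannianMetric IM gM)
    (hgB : IsSemiRiemannianMetric IB gB) (hπ : IsHarmonicSubmersion IM IB gM gB π)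
    (hε : ε = 1 ∨ ε = -1) (hu : ContMDiff IB 𝓘(ℝ, ℝ) 2 u) (x : M) {ξ : EB}
    (hξ : IsGradientAt IB gB u (π x) ξ) (hW : ε + metricAt IB gB (π x) ξ ξ ≠ 0)
    {j : EB →ₗ[ℝ] EM} (hj : ∀ b, tangentMapAt IM IB π x (j b) = b)
    (hj' : ∀ b v, metricAt IM gM x (j b) v = metricAt IB gB (π x) b (tangentMapAt IM IB π x v)) :
    metricTrace (fun v v' : EM => graphForm IM gM ε (u ∘ π) x v v')
        (fun v v' => hessianForm gM (u ∘ π) x (j ξ) v v') =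
      metricTrace (fun v v' : EB => graphForm IB gB ε u (π x) v v')
        (fun v v' => hessianForm gB u (π x) ξ v v') := by
  have hsub := hπ.toIsSemiRiemannianSubmersion
  obtain ⟨k, f, U, hf, hmc⟩ := hπ.minimal_fibers x
  obtain rfl := hf.map_zero
  set x := f 0 with hx
  have hU : U ∈ 𝓝 (0 : EuclideanSpace ℝ (Fin k)) := hf.isOpen.mem_nhds hf.zero_mem
  have hfC : ContMDiffAt (𝓡 k) IM ∞ f 0 := hf.smoothOn.contMDiffAt hU
  have hw : ContMDiff IM 𝓘(ℝ, ℝ) 2 (u ∘ π) := hu.comp (hsub.smooth.of_le (by norm_cast))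
  set P := tangentMapAt IM IB π x with hP
  set i : EuclideanSpace ℝ (Fin k) →L[ℝ] EM := tangentMapAt (𝓡 k) IM f 0 with hi
  have hPi : ∀ a, P (i a) = 0 := by
    intro a
    have h1 := ((hsub.smooth (f 0)).mdifferentiableAt (by simp)).hasMFDerivAt.comp 0
      (hfC.mdifferentiableAt (by simp)).hasMFDerivAt
    have h2 : π ∘ f =ᶠ[𝓝 0] fun _ => π (f 0) := by
      filter_upwards [hU] with y hy
      exact hf.mem_fiber y hy
    have h3 := hasMFDerivAt_unique ((hasMFDerivAt_const (I := 𝓡 k) (I' := IB) (π (f 0))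
      (0 : EuclideanSpace ℝ (Fin k))).congr_of_eventuallyEq h2) h1
    exact (DFunLike.congr_fun h3 a).symm
  have hdw : ∀ v, differentialAt IM (u ∘ π) x v = differentialAt IB u (π x) (P v) :=
    differentialAt_comp hsub hu x
  have hinj : Function.Injective ((i : EuclideanSpace ℝ (Fin k) →ₗ[ℝ] EM).coprod j) := by
    rw [injective_iff_map_eq_zero]
    rintro ⟨a, b⟩ hab
    have hab' : i a + j b = 0 := hab
    have hb : b = 0 := by
      have := congrArg P hab'
      rwa [map_add, hPi, hj, zero_add, map_zero] at this
    subst hb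
    rw [map_zero, add_zero] at hab'
    have ha : a = 0 := by
      refine hf.injective_mfderiv 0 hf.zero_mem ?_
      exact Eq.trans hab' (i.map_zero).symm
    rw [ha]; rfl
  -- The vertical-horizontal splitting of the tangent space; injectivity suffices since the fiber
  -- has the complementary dimension.
  set e : (EuclideanSpace ℝ (Fin k) × EB) ≃ₗ[ℝ] EM :=
    LinearEquiv.ofInjectiveOfFinrankEq _ hinj (by
      rw [Module.finrank_prod, finrank_euclideanSpace_fin]; exact hf.dim_eq)
  have he : ∀ a b, e (a, b) = i a + j b := fun a b => rfl
  have he1 : ∀ a, e (a, 0) = i a := fun a => by rw [he, map_zero, add_zero]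
  have he2 : ∀ b, e (0, b) = j b := fun b => by rw [he, map_zero, zero_add]
  have hgf : ∀ v v', graphForm IM gM ε (u ∘ π) x v v' = metricAt IM gM x v v' +
      ε * (differentialAt IB u (π x) (P v) * differentialAt IB u (π x) (P v')) := fun v v' => by
    rw [← hdw, ← hdw]; rfl
  have hgi : ∀ a v, graphForm IM gM ε (u ∘ π) x (i a) v = metricAt IM gM x (i a) v := by
    intro a v
    rw [hgf, hPi, map_zero]; ring
  have hgj : ∀ b b', graphForm IM gM ε (u ∘ π) x (j b) (j b') =
      graphForm IB gB ε u (π x) b b' := by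
    intro b b'
    rw [hgf, hj, hj, hj', hj]; rfl
  have hij : ∀ a b, metricAt IM gM x (i a) (j b) = 0 := by
    intro a b
    rw [metricAt_symm hgM, hj', hPi, map_zero]
  have hgrad : IsGradientAt IM gM (u ∘ π) x (j ξ) := fun v => by
    rw [hj', hdw, hξ]
  rw [metricTrace_eq_add_of_orthogonal _ _ e]
  · simp only [he1, he2, hgj]
    have hH : ∀ b b', hessianForm gM (u ∘ π) x (j ξ) (j b) (j b') = hessianForm gB u (π x) ξ b b' :=
      hessianForm_horizontal hgM hgB hsub hu hξ hj hj'
    simp only [hH]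
    have hV : metricTrace (fun a a' => graphForm IM gM ε (u ∘ π) x (i a) (i a'))
        (fun a a' => hessianForm gM (u ∘ π) x (j ξ) (i a) (i a')) = 0 := by
      have hconst : ∀ᶠ y in 𝓝 0, (u ∘ π) (f y) = (u ∘ π) (f 0) := by
        filter_upwards [hU] with y hy
        exact congrArg u (hf.mem_fiber y hy)
      have hS := hessianForm_tangent_of_const (hfC.of_le (by norm_cast)) (hw (f 0)) hconst hgrad hgM
      have hS' : ∀ a a', hessianForm gM (u ∘ π) x (j ξ) (i a) (i a') =
          (-1) * secondFundamentalForm (𝓡 k) IM gM f 0 (j ξ) a a' := hS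
      simp only [hS', hgi]
      -- Minimality is used only here, tested against the lifted gradient, which is horizontal and
      -- so normal to the fiber.
      have h1 := hmc.2 (j ξ) (fun a => hij a ξ)
      have h2 : gM (f 0) 0 (j ξ) = 0 := congrArg (fun L : EM →L[ℝ] ℝ => L (j ξ)) (gM (f 0)).map_zero
      have h3 : metricTrace (fun a a' => metricAt IM gM x (i a) (i a'))
        (secondFundamentalForm (𝓡 k) IM gM f 0 (j ξ)) = 0 := h1.symm.trans h2
      exact (metricTrace_smul (V := EuclideanSpace ℝ (Fin k)) _
        (secondFundamentalForm (𝓡 k) IM gM f 0 (j ξ)) (-1)).trans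
        ((congrArg ((-1) * ·) h3).trans (mul_zero _))
    rw [hV, zero_add]
  · intro a b
    rw [he1, he2, hgi, hij]
  · intro a b
    rw [he1, he2, hgf, hPi, map_zero, metricAt_symm hgM, hij]; ring
  · intro a ha
    simp only [he1, hgi] at ha
    -- Nondegeneracy of the fiber tests against the whole kernel of `dπ`; the splitting shows that
    -- this kernel is the image of `i`.
    have h0 : i a = 0 := by
      refine hsub.fiber_nondegenerate x (i a) (hPi a) fun v hv => ?_
      obtain ⟨⟨a', b'⟩, rfl⟩ := e.surjective v
      have hb : b' = 0 := by
        have hv' : P (e (a', b')) = 0 := hv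
        rwa [he, map_add, hPi, hj, zero_add] at hv'
      subst hb
      change metricAt IM gM x (i a) (e (a', 0)) = 0
      rw [he1, ha]
    exact hf.injective_mfderiv 0 hf.zero_mem (Eq.trans h0 (i.map_zero).symm)
  · intro b hb
    simp only [he2, hgj] at hb
    exact graphForm_nondegenerate hgB hε hξ hW b hb

end Lifting
theorem mainTheorem5
    {EM : Type*} [NormedAddCommGroup EM] [NormedSpace ℝ EM] [FiniteDimensional ℝ EM]
    {HM : Type*} [TopologicalSpace HM] (IM : ModelWithCorners ℝ EM HM) [IM.Boundaryless]
    {M : Type*} [TopologicalSpace M] [ChartedSpace HM M] [IsManifold IM ∞ M]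
    {EB : Type*} [NormedAddCommGroup EB] [NormedSpace ℝ EB] [FiniteDimensional ℝ EB]
    {HB : Type*} [TopologicalSpace HB] (IB : ModelWithCorners ℝ EB HB) [IB.Boundaryless]
    {B : Type*} [TopologicalSpace B] [ChartedSpace HB B] [IsManifold IB ∞ B]
    (gM : TangentBilinField IM M) (hgM : IsSemiRiemannianMetric IM gM)
    (gB : TangentBilinField IB B) (hgB : IsSemiRiemannianMetric IB gB)
    (π : M → B) (hπ : IsHarmonicSubmersion IM IB gM gB π)
    (ε : ℝ) (hε : ε = 1 ∨ ε = -1)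
    (u : B → ℝ) (hu : ContMDiff IB 𝓘(ℝ, ℝ) 2 u) :
    IsGraphicalTranslatingSoliton IM gM ε (u ∘ π) ↔
      IsGraphicalTranslatingSoliton IB gB ε u := by

  have hsub := hπ.toIsSemiRiemannianSubmersion
  choose ξ hξ using fun b : B => exists_isGradientAt hgB u b
  choose j hj hj' using fun x : M => hsub.exists_horizontalLift hgM hgB x
  have hw : ContMDiff IM 𝓘(ℝ, ℝ) 2 (u ∘ π) := hu.comp (hsub.smooth.of_le (by norm_cast))
  have hgrad : ∀ x, IsGradientAt IM gM (u ∘ π) x (j x (ξ (π x))) := fun x v => by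
    rw [hj', differentialAt_comp hsub hu, hξ]
  rw [isGraphicalTranslatingSoliton_iff hgM hε hw _ hgrad,
    isGraphicalTranslatingSoliton_iff hgB hε hu _ hξ]
  have hsq : ∀ x, metricAt IM gM x (j x (ξ (π x))) (j x (ξ (π x))) =
      metricAt IB gB (π x) (ξ (π x)) (ξ (π x)) := fun x => by rw [hj', hj]
  simp only [hsq]
  have hsgn : (∃ ε' : ℝ, (ε' = 1 ∨ ε' = -1) ∧
        ∀ x, 0 < ε' * (ε + metricAt IB gB (π x) (ξ (π x)) (ξ (π x)))) ↔
      ∃ ε' : ℝ, (ε' = 1 ∨ ε' = -1) ∧ ∀ b, 0 < ε' * (ε + metricAt IB gB b (ξ b) (ξ b)) :=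
    exists_congr fun ε' => and_congr_right fun _ => (hsub.surjective.forall
      (p := fun b => 0 < ε' * (ε + metricAt IB gB b (ξ b) (ξ b)))).symm
  -- The traces are compared under the sign condition, which makes `W` nonzero and hence the metric
  -- induced on the graph over `B` nondegenerate.
  rw [hsgn, and_congr_right_iff]
  rintro ⟨ε', -, hW⟩
  rw [hsub.surjective.forall]
  refine forall_congr' fun x => ?_
  have hW0 : ε + metricAt IB gB (π x) (ξ (π x)) (ξ (π x)) ≠ 0 := fun h0 => by
    have := hW (π x)
    rw [h0, mul_zero] at this
    exact lt_irrefl _ this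
  rw [metricTrace_hessianForm_comp hgM hgB hπ hε hu x (hξ (π x)) hW0 (hj x) (hj' x)]
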